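/- **Setting.** Let $A$ be a finite non-empty set of advertisers with budgets $B_a>0$, known upfront. In AdWords, impressions $i$ arrive one at a time with bids $b_{ai}\ge 0$; each must be assigned immediately and irrevocably to an advertiser, and the payoff of an assignment that gives $a$ the set $S_a$ is $\sum_a \min\{\sum_{i\in S_a} b_{ai},\,B_a\}$. A randomized online algorithm is $\Gamma$-competitive if on every instance its expected payoff is at least $\Gamma$ times the offline optimum. **Panoramic interval-level assignment.** A sequence of rounds is given in advance. Each round is either deterministic, naming one advertiser $a$ and a size $b\in[0,B_a]$, or randomized, naming two distinct advertisers with a size for each. Every named advertiser gets a subset of $[0,B_a)$, regarded as a circle: for a pointer $y^*$, initially $0$, and the set $Y_D$ of points of $[0,B_a)$ assigned in earlier deterministic rounds, the subset is $[y^*,\,y^*\oplus_{Y_D} b)\setminus Y_D$, where $y^*\oplus_{Y_D} b$ is the point reached from $y^*$ by scanning the circle upwards until measure $b$ outside $Y_D$ has been collected (one full turn if the available measure is at most $b$); then $y^*$ moves to $y^*\oplus_{Y_D}b$. In a deterministic round the impression, hence every point of the subset, is assigned. In a randomized round the impression is *semi-assigned* to the two advertiser-subset combinations, and the points of both subsets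 are semi-assigned once more; if one of the combinations is then selected, its points become assigned. For $y\in[0,B_a)$ let $k_a(y)$ be the number of times that $y$ is semi-assigned, or $\infty$ if $y$ is assigned in a deterministic round, and let $x_a(y)$ be the probability that $y$ is assigned. **PanOCS.** A PanOCS is a randomized online algorithm that receives the pairs of combinations of the randomized rounds one at a time and selects one combination of each pair. For $0\le\gamma\le 1$ it is a $\gamma$-PanOCS for a class of such sequences of rounds if, for every sequence in the class, every $a$ and every $y\in[0,B_a)$, $$x_a(y)\ \ge\ 1-2^{-k_a(y)}(1-\gamma)^{\max\{k_a(y)-1,\,0\}}$$ (the right-hand side is $1$ if $k_a(y)=\infty$). **Theorem.** 1. For every integer $k_{\max}\ge 1$ there is a $\frac{0.01245}{k_{\max}}$-PanOCS for the panoramic interval-level assignments of arbitrary sizes in which every point of every advertiser is semi-assigned at most $k_{\max}$ times. 2. There is a deterministic online rule which, from the bids revealed so far, chooses for each impression a round as above, with sizes at most the corresponding bids, such that every point is semi-assigned at most $18$ times on every instance, and such that following this rule while letting any $\frac{0.01245}{18}$-PanOCS (for $k_{\max}=18$) decide the randomized rounds is a $0.50005$-competitive algorithm for AdWords with general bids.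 In particular, a $0.50005$-competitive algorithm for AdWords exists. -/

import Mathlib

open MeasureTheory Set

/-! ## Randomized online algorithms -/

/-- A randomized online algorithm which receives inputs of type `X` one at a time and answers each
of them immediately and irrevocably by an element of `Y`. A random seed is drawn once; `act ω l` is
the answer to the last input of `l`, where `l` lists, in the order of arrival, all inputs revealed
so far. Thus an answer depends on the seed, on the current input and on the past inputs only. -/
structure OnlineAlgorithm (X Y : Type*) where
  Seed : Type
  measurableSpaceSeed : MeasurableSpace Seed
  law : Measure Seed
  isProbabilityMeasure_law : IsProbabilityMeasure law
  act : Seed → List X → Y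
  measurableSet_act : ∀ (l : List X) (y : Y), MeasurableSet {ω | act ω l = y}

attribute [instance] OnlineAlgorithm.measurableSpaceSeed
  OnlineAlgorithm.isProbabilityMeasure_law

noncomputable section

/-! ## AdWords

`A` is the set of advertisers, `B a` is the budget of `a`. An instance is the list of impressions
in the order of arrival; an impression is the function that gives the bid of every advertiser. -/

section AdWords

variable {A : Type*} [Fintype A] [DecidableEq A]

/-- Total budget-additive payment when impression `t` is assigned to advertiser `f t`. -/
def payoff (B : A → ℝ) (I : List (A → ℝ)) (f : Fin I.length → A) : ℝ :=
  ∑ a, min (∑ t with f t = a, I[t] a) (B a)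

/-- The offline optimum in hindsight. -/
def offlineOpt (B : A → ℝ) (I : List (A → ℝ)) : ℝ :=
  ⨆ f : Fin I.length → A, payoff B I f

/-- `alg` is `Γ`-competitive: on every instance with non-negative bids its expected payoff is at
least `Γ` times the offline optimum. -/
def IsCompetitive (B : A → ℝ) (Γ : ℝ) (alg : OnlineAlgorithm (A → ℝ) A) : Prop :=
  ∀ I : List (A → ℝ), (∀ bid ∈ I, ∀ a, 0 ≤ bid a) →
    Γ * offlineOpt B I ≤
      ∫ ω, payoff B I (fun t => alg.act ω (I.take (t + 1))) ∂alg.law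

end AdWords

/-! ## The panoramic interval-level assignment

The interval `[0, β)` is regarded as a circle. -/

/-- Distance travelled from `y` to `z` when the circle `[0, β)` is scanned upwards. -/
def circOffset (β y z : ℝ) : ℝ := if y ≤ z then z - y else z - y + β

/-- The half-open arc of length `t` of the circle `[0, β)` which starts at `y`. -/
def circArc (β y t : ℝ) : Set ℝ := {z | z ∈ Ico 0 β ∧ circOffset β y z < t}

/-- How far one has to scan from `y` in order to collect measure `b` outside of `D`; this is a full
turn `β` if the measure that is available outside of `D` does not exceed `b`. -/
def scanLength (β : ℝ) (D : Set ℝ) (y b : ℝ) : ℝ :=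
  sSup {t | t ∈ Icc 0 β ∧ volume.real (circArc β y t \ D) ≤ b}

/-- The end point `y ⊕_D b` of the scan, a point of the circle `[0, β)`. -/
def circAdd (β : ℝ) (D : Set ℝ) (y b : ℝ) : ℝ :=
  if y + scanLength β D y b < β then y + scanLength β D y b
  else y + scanLength β D y b - β

/-- The subset `[y, y ⊕_D b) \ D` found by the scan. -/
def scanSet (β : ℝ) (D : Set ℝ) (y b : ℝ) : Set ℝ :=
  circArc β y (scanLength β D y b) \ D

/-- A round before the subsets are determined. `det a b`: the impression is assigned to `a`, with a
subset of size `b`. `rand a₁ b₁ a₂ b₂`: the impression is semi-assigned to `a₁` with a subset of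
size `b₁` and to `a₂` with a subset of size `b₂`. -/
inductive Round (A : Type*) where
  | det (a : A) (b : ℝ)
  | rand (a₁ : A) (b₁ : ℝ) (a₂ : A) (b₂ : ℝ)

/-- Sizes are between zero and the budget, and the two advertisers of a randomized round differ. -/
def Round.Valid {A : Type*} (B : A → ℝ) : Round A → Prop
  | .det a b => 0 ≤ b ∧ b ≤ B a
  | .rand a₁ b₁ a₂ b₂ => a₁ ≠ a₂ ∧ (0 ≤ b₁ ∧ b₁ ≤ B a₁) ∧ (0 ≤ b₂ ∧ b₂ ≤ B a₂)

/-- The sizes used in the round are at most the bids for the impression. -/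
def Round.RespectsBids {A : Type*} (bid : A → ℝ) : Round A → Prop
  | .det a b => b ≤ bid a
  | .rand a₁ b₁ a₂ b₂ => b₁ ≤ bid a₁ ∧ b₂ ≤ bid a₂

/-- An advertiser together with a subset of its interval `[0, B a)`. -/
abbrev Combination (A : Type*) := A × Set ℝ

/-- A round with its subsets. -/
inductive Step (A : Type*) where
  | det (c : Combination A)
  | rand (c₁ c₂ : Combination A)

/-- For every advertiser `a`, the point `start a` at which the next subset starts, and the set
`assigned a` of the points that have been assigned in deterministic rounds. -/
structure PanState (A : Type*) where
  start : A → ℝ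
  assigned : A → Set ℝ

/-- The subset of size `b` that advertiser `a` would get next. -/
def PanState.nextSet {A : Type*} (B : A → ℝ) (s : PanState A) (a : A) (b : ℝ) : Set ℝ :=
  scanSet (B a) (s.assigned a) (s.start a) b

/-- The starting point of advertiser `a` after it got a subset of size `b`. -/
def PanState.nextStart {A : Type*} (B : A → ℝ) (s : PanState A) (a : A) (b : ℝ) : ℝ :=
  circAdd (B a) (s.assigned a) (s.start a) b

section Panorama

variable {A : Type*} [DecidableEq A]

/-- The state after a round. -/
def PanState.next (B : A → ℝ) (s : PanState A) : Round A → PanState A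
  | .det a b =>
      { start := Function.update s.start a (s.nextStart B a b)
        assigned := Function.update s.assigned a (s.assigned a ∪ s.nextSet B a b) }
  | .rand a₁ b₁ a₂ b₂ =>
      { start := Function.update (Function.update s.start a₁ (s.nextStart B a₁ b₁))
          a₂ (s.nextStart B a₂ b₂)
        assigned := s.assigned }

/-- The round, with the subsets that it gets in state `s`. -/
def PanState.step (B : A → ℝ) (s : PanState A) : Round A → Step A
  | .det a b => .det (a, s.nextSet B a b)
  | .rand a₁ b₁ a₂ b₂ => .rand (a₁, s.nextSet B a₁ b₁) (a₂, s.nextSet B a₂ b₂)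

/-- The steps that result from a list of rounds, beginning in state `s`. -/
def stepsFrom (B : A → ℝ) : PanState A → List (Round A) → List (Step A)
  | _, [] => []
  | s, r :: R => s.step B r :: stepsFrom B (s.next B r) R

/-- The panoramic interval-level assignment of a list of rounds: scanning starts at `0`, and no
point is deterministically assigned at first. -/
def panoramicSteps (B : A → ℝ) (R : List (Round A)) : List (Step A) :=
  stepsFrom B ⟨fun _ => 0, fun _ => ∅⟩ R

end Panorama

/-! ## Panoramic online correlated selection -/

section PanOCS

variable {A : Type*}

/-- Point `y` of advertiser `a` is assigned in a deterministic round. -/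
def Step.Assigns (a : A) (y : ℝ) : Step A → Prop
  | .det c => c.1 = a ∧ y ∈ c.2
  | .rand _ _ => False

/-- Point `y` of advertiser `a` is semi-assigned in a randomized round. -/
def Step.SemiAssigns (a : A) (y : ℝ) : Step A → Prop
  | .det _ => False
  | .rand c₁ c₂ => (c₁.1 = a ∧ y ∈ c₁.2) ∨ (c₂.1 = a ∧ y ∈ c₂.2)

/-- The pair of combinations of a randomized round. -/
def Step.pair : Step A → Option (Combination A × Combination A)
  | .det _ => none
  | .rand c₁ c₂ => some (c₁, c₂)

/-- The sequence of the pairs of the randomized rounds, which is what a PanOCS gets to see. -/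
def randomizedPairs (T : List (Step A)) : List (Combination A × Combination A) :=
  T.filterMap Step.pair

open Classical in
/-- The number of times that point `y` of advertiser `a` is semi-assigned. -/
def semiCount (T : List (Step A)) (a : A) (y : ℝ) : ℕ :=
  T.countP (fun s => s.SemiAssigns a y)

open Classical in
/-- `k_a(y)`: the number of semi-assignments of `y`, or `∞` if `y` is assigned in a deterministic
round. -/
def kValue (T : List (Step A)) (a : A) (y : ℝ) : ℕ∞ :=
  if ∃ s ∈ T, s.Assigns a y then ⊤ else (semiCount T a y : ℕ∞)

/-- An online algorithm that selects one combination of each pair: `true` selects the first one,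
`false` the second one. -/
abbrev PairSelector (A : Type*) := OnlineAlgorithm (Combination A × Combination A) Bool

/-- The combination to which the impression of round `t` is assigned, when the randomized rounds
are decided by `P` with seed `ω`. -/
def outcome (P : PairSelector A) (T : List (Step A)) (ω : P.Seed) (t : Fin T.length) :
    Combination A :=
  match T[t] with
  | .det c => c
  | .rand c₁ c₂ => if P.act ω (randomizedPairs (T.take (t + 1))) then c₁ else c₂

/-- `x_a(y)`: the probability that point `y` of advertiser `a` is assigned. -/
def assignProb (P : PairSelector A) (T : List (Step A)) (a : A) (y : ℝ) : ℝ :=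
  P.law.real {ω | ∃ t : Fin T.length, (outcome P T ω t).1 = a ∧ y ∈ (outcome P T ω t).2}

/-- `1 - 2 ^ (-k) * (1 - γ) ^ max (k - 1) 0`, with value `1` at `k = ∞`. -/
def panocsBound (γ : ℝ) (k : ℕ∞) : ℝ :=
  if k = ⊤ then 1 else 1 - (1 / 2) ^ k.toNat * (1 - γ) ^ (k.toNat - 1)

/-- `P` is a `γ`-PanOCS for panoramic interval-level assignments which semi-assign every point at
most `kmax` times. -/
def IsPanOCS [DecidableEq A] (B : A → ℝ) (kmax : ℕ) (γ : ℝ) (P : PairSelector A) : Prop :=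
  (0 ≤ γ ∧ γ ≤ 1) ∧
  ∀ R : List (Round A), (∀ r ∈ R, r.Valid B) →
    (∀ a, ∀ y ∈ Ico 0 (B a), semiCount (panoramicSteps B R) a y ≤ kmax) →
    ∀ a, ∀ y ∈ Ico 0 (B a),
      panocsBound γ (kValue (panoramicSteps B R) a y) ≤ assignProb P (panoramicSteps B R) a y

end PanOCS

/-! ## Oblivious semi-randomized algorithms -/

section Oblivious

variable {A : Type*}

/-- The random-bit-oblivious part of an oblivious semi-randomized algorithm: it decides which
rounds are deterministic, and chooses the advertisers and sizes. `plan l` is the round of the last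
impression of `l`, where `l` lists the impressions that have arrived so far. -/
abbrev Planner (A : Type*) := List (A → ℝ) → Round A

/-- The rounds chosen for all the impressions of `I`. -/
def Planner.rounds (plan : Planner A) (I : List (A → ℝ)) : List (Round A) :=
  (List.range I.length).map fun t => plan (I.take (t + 1))

variable [DecidableEq A]

/-- On every instance with non-negative bids, all rounds are valid, the size of each subset is at
most the corresponding bid, and every point is semi-assigned at most `kmax` times. -/
def Planner.Admissible (B : A → ℝ) (kmax : ℕ) (plan : Planner A) : Prop :=
  ∀ I : List (A → ℝ), (∀ bid ∈ I, ∀ a, 0 ≤ bid a) →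
    (∀ t : Fin I.length, (plan (I.take (t + 1))).Valid B ∧
      (plan (I.take (t + 1))).RespectsBids I[t]) ∧
    ∀ a, ∀ y ∈ Ico 0 (B a), semiCount (panoramicSteps B (plan.rounds I)) a y ≤ kmax

/-- The online algorithm that follows `plan`, determines the subsets by the panoramic
interval-level assignment, and lets `P` decide the randomized rounds. -/
def Planner.combine (B : A → ℝ) (plan : Planner A) (P : PairSelector A) :
    OnlineAlgorithm (A → ℝ) A where
  Seed := P.Seed
  measurableSpaceSeed := P.measurableSpaceSeed
  law := P.law
  isProbabilityMeasure_law := P.isProbabilityMeasure_law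
  act ω I :=
    match plan I with
    | .det a _ => a
    | .rand a₁ _ a₂ _ =>
        if P.act ω (randomizedPairs (panoramicSteps B (plan.rounds I))) then a₁ else a₂
  measurableSet_act I a := by
    cases plan I with
    | det a' b => exact MeasurableSet.const (a' = a)
    | rand a₁ b₁ a₂ b₂ =>
      have h := P.measurableSet_act (randomizedPairs (panoramicSteps B (plan.rounds I))) true
      have h' := (h.inter (MeasurableSet.const (a₁ = a))).union
        (h.compl.inter (MeasurableSet.const (a₂ = a)))
      convert h' using 1
      ext ω
      simp only [mem_ofPred_eq, mem_union, mem_inter_iff, mem_compl_iff]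
      split_ifs with h1 <;> simp [h1]

end Oblivious

end

/-! PanOCS. Each semi-assigned subset gets a colour, roughly twice the number of its earlier
semi-assignments (`setColor`). Outside the deterministically assigned points, counts differ by at
most one and every scan takes lowest counts first (`IsLevel`, `Trace`). Hence the successive
semi-assignments of one point have strictly increasing colours with gaps at most 4
(`Trace.setColor_lt`), and K = 2 kmax - 1 colours suffice. A randomized round becomes an edge
between two vertices (advertiser, colour), and `orientSelector` reads off an orientation of all
conceivable edges drawn in advance. Repeated edges are oriented alike; this is harmless, since the
edges of a point meet its advertiser at distinct colours.

The orientation creates negative correlation. Each edge follows a random one of its ends and reads a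
fair bit attached to that end and to the colour of the other end. The colours of an advertiser are
matched at a random distance in {1, 2, 3, 4}; the upper colour of a pair reads the negated bits of
the lower one, after a random cyclic shift of the partner colours. Two successive edges of a point
are matched with probability 1/8, both follow its advertiser with probability 1/4, and then read the
same bit with probability 1/K, in which case exactly one of them selects the point. Edges of a point
that share a bit always want opposite values of it (`EdgeAt.bitVal_ne`), so no correlation hurts.
This gives `expect_never_selected_le`; its 36 instead of 32 = 8 * 4 pays for linearizing a power.

AdWords. The argument is primal-dual. With δ = `semiWeight`, A = `ownWeight` and Γ = 0.50005, the
k-th earlier count of a semi-assigned point gives δ k to the impression, and A k of the final count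
stays with the advertiser. The greedy rule compares the values of the offers, that is, the integrals
of δ over the offered subsets: it is deterministic if one value is at least four times every other,
and otherwise semi-assigns the two best. The dual value of the impression is then at least 5/4 of
the value of a semi-assigned offer and twice that of a rejected one (`IsGreedyRound.value_cases`).
Together with A k + 2 δ k ≥ Γ and A (k+1) + 5/4 δ k ≥ Γ this yields approximate dual feasibility,
`Trace.dual_feasible`, so the dual value is at least Γ times the optimum. Conversely, pointwise the
gains sum to at most the probability guaranteed by a PanOCS (`own_add_sum_pointGain_le`), and by
Fubini the expected payoff is at least the dual value (`dual_le_payoff`). -/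

noncomputable section

set_option linter.unusedSectionVars false

open scoped BigOperators

/-! ## Averages over finite product spaces -/

section Averages

variable {J Z : Type*} [Fintype J] [DecidableEq J] [Fintype Z] [Nonempty Z]

/-- Averages multiply if the two factors depend on disjoint sets of coordinates. -/
lemma expect_mul_eq_of_disjoint_coords (S : Set J) (f g : (J → Z) → ℝ)
    (hf : ∀ z z', (∀ j ∈ S, z j = z' j) → f z = f z')
    (hg : ∀ z z', (∀ j ∉ S, z j = z' j) → g z = g z') :
    𝔼 z, f z * g z = (𝔼 z, f z) * 𝔼 z, g z := by
  classical
  rw [Fintype.expect_mul_expect]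
  -- Two independent copies exchange their coordinates outside `S`; this involution turns f(z) g(z')
  -- into f and g evaluated at one point.
  let mix : (J → Z) → (J → Z) → (J → Z) := fun z z' j => if j ∈ S then z j else z' j
  have hmix : ∀ z z', mix (mix z z') (mix z' z) = z := by
    intro z z'; funext j; simp only [mix]; split_ifs <;> rfl
  let e : (J → Z) × (J → Z) ≃ (J → Z) × (J → Z) :=
    { toFun := fun p => (mix p.1 p.2, mix p.2 p.1)
      invFun := fun p => (mix p.1 p.2, mix p.2 p.1)
      left_inv := fun p => by simp [hmix]
      right_inv := fun p => by simp [hmix] }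
  have h1 : 𝔼 p : (J → Z) × (J → Z), f p.1 * g p.2 =
      𝔼 p : (J → Z) × (J → Z), f p.1 * g p.1 := by
    refine Fintype.expect_equiv e _ _ fun p => ?_
    have a1 : f (e p).1 = f p.1 := hf _ _ fun j hj => by simp [e, mix, hj]
    have a2 : g (e p).1 = g p.2 := hg _ _ fun j hj => by simp [e, mix, hj]
    rw [a1, a2]
  have h2 : ∀ F : (J → Z) → (J → Z) → ℝ,
      𝔼 p : (J → Z) × (J → Z), F p.1 p.2 = 𝔼 z, 𝔼 z', F z z' := by
    intro F
    rw [← Finset.expect_product' Finset.univ Finset.univ F, Finset.univ_product_univ]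
  rw [h2 fun z z' => f z * g z', h2 fun z _ => f z * g z] at h1
  rw [h1]
  simp

/-- Averages of products of functions of pairwise disjoint sets of coordinates. -/
lemma expect_prod_eq_of_disjoint_coords {ι : Type*} (s : Finset ι) (T : ι → Set J)
    (f : ι → (J → Z) → ℝ) (hT : ∀ i ∈ s, ∀ i' ∈ s, i ≠ i' → Disjoint (T i) (T i'))
    (hf : ∀ i ∈ s, ∀ z z', (∀ j ∈ T i, z j = z' j) → f i z = f i z') :
    𝔼 z, ∏ i ∈ s, f i z = ∏ i ∈ s, 𝔼 z, f i z := by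
  classical
  induction s using Finset.induction_on with
  | empty => simp
  | insert a s ha ih =>
    simp only [Finset.prod_insert ha]
    rw [← ih (fun i hi i' hi' => hT i (Finset.mem_insert_of_mem hi) i' (Finset.mem_insert_of_mem hi'))
      (fun i hi => hf i (Finset.mem_insert_of_mem hi))]
    refine expect_mul_eq_of_disjoint_coords (T a) _ _ (hf a (Finset.mem_insert_self _ _)) ?_
    intro z z' h
    refine Finset.prod_congr rfl fun i hi => hf i (Finset.mem_insert_of_mem hi) z z' fun j hj => ?_
    refine h j fun hja => ?_
    exact Set.disjoint_left.1 (hT a (Finset.mem_insert_self _ _) i (Finset.mem_insert_of_mem hi)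
      (by rintro rfl; exact ha hi)) hja hj

lemma expect_coord (j : J) (h : Z → ℝ) : 𝔼 z : J → Z, h (z j) = 𝔼 x, h x := by
  rw [Fintype.expect_equiv (Equiv.funSplitAt j Z) (fun z => h (z j)) (fun p => h p.1)
    (fun z => by simp [Equiv.funSplitAt])]
  rw [← Finset.univ_product_univ, Finset.expect_product]
  simp

lemma expect_prod_coords {ι : Type*} (s : Finset ι) (k : ι → J) (hk : Set.InjOn k s)
    (h : ι → Z → ℝ) : 𝔼 z : J → Z, ∏ i ∈ s, h i (z (k i)) = ∏ i ∈ s, 𝔼 x, h i x := by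
  rw [expect_prod_eq_of_disjoint_coords s (fun i => {k i}) (fun i z => h i (z (k i)))]
  · exact Finset.prod_congr rfl fun i _ => expect_coord (k i) (h i)
  · intro i hi i' hi' hne
    exact Set.disjoint_singleton.2 fun he => hne (hk hi hi' he)
  · intro i _ z z' hz
    rw [hz (k i) rfl]

end Averages

/-- Prescribed values of independent fair bits. Coinciding keys are prescribed opposite values. -/
lemma expect_bits_le {J ι : Type*} [Fintype J] [DecidableEq J] (s : Finset ι) (key : ι → J)
    (val : ι → Bool)
    (hopp : ∀ i ∈ s, ∀ i' ∈ s, i ≠ i' → key i = key i' → val i ≠ val i') :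
    𝔼 y : J → Bool, (if ∀ i ∈ s, y (key i) = val i then (1 : ℝ) else 0) ≤ (1 / 2) ^ s.card ∧
    (¬ Set.InjOn key s →
      𝔼 y : J → Bool, (if ∀ i ∈ s, y (key i) = val i then (1 : ℝ) else 0) = 0) := by
  have hz : ¬ Set.InjOn key s →
      𝔼 y : J → Bool, (if ∀ i ∈ s, y (key i) = val i then (1 : ℝ) else 0) = 0 := by
    intro hinj
    refine Finset.expect_eq_zero fun y _ => if_neg fun hy => hinj ?_
    -- A shared key would have to carry two opposite values, so a single collision makes the event
    -- impossible.
    intro i hi i' hi' he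
    by_contra hne
    exact hopp i hi i' hi' hne he (by rw [← hy i hi, ← hy i' hi', he])
  refine ⟨?_, hz⟩
  by_cases hinj : Set.InjOn key s
  · have h1 : ∀ y : J → Bool, (if ∀ i ∈ s, y (key i) = val i then (1 : ℝ) else 0) =
        ∏ i ∈ s, if y (key i) = val i then (1 : ℝ) else 0 := by
      intro y; rw [Finset.prod_ite_zero]; simp
    simp only [h1]
    rw [expect_prod_coords s key hinj (fun i x => if x = val i then (1 : ℝ) else 0)]
    simp
  · rw [hz hinj]; positivity

/-! ## A random orientation of a complete multipartite graph

The vertices are pairs of an advertiser and a colour. -/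

section Orientation

variable {N : Type} {K : ℕ}

/-- The seed: for every advertiser a step in `{1, 2, 3, 4}` and a parity, which match colours with
each other; shifts (first components at left indices); for every edge the choice of the end that it
follows (second components at right indices); and the bits. -/
abbrev OrientSeed (N : Type) (K : ℕ) :=
  (N → Fin 4 × Bool) ×
    (((N × Fin (K + 4)) ⊕ ((N × Fin K) × (N × Fin K)) → Fin K × Bool) ×
      (N × Fin (K + 4) × Fin K → Bool))

namespace OrientSeed

/-- Colour `c` is the lower one of its pair. -/
def IsLower (m : Fin 4 × Bool) (c : ℕ) : Prop := (c / (m.1 + 1)) % 2 = if m.2 then 1 else 0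

instance (m : Fin 4 × Bool) (c : ℕ) : Decidable (IsLower m c) := by
  unfold IsLower; infer_instance

/-- The index of the pair of `c`. -/
def pairIndex (m : Fin 4 × Bool) (c : Fin K) : Fin (K + 4) :=
  -- The offset 4 prevents truncated subtraction: an upper colour without a partner below it gets an
  -- index less than 4, which no lower colour has.
  if IsLower m c then ⟨c + 4, by omega⟩ else ⟨c + 4 - (m.1 + 1), by omega⟩

/-- The index of the bit that is used at vertex `(a, c)` with partner colour `v`. -/
def key (m : N → Fin 4 × Bool)
    (z : (N × Fin (K + 4)) ⊕ ((N × Fin K) × (N × Fin K)) → Fin K × Bool) (u : N × Fin K)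
    (v : Fin K) : N × Fin (K + 4) × Fin K :=
  (u.1, pairIndex (m u.1) u.2,
    if IsLower (m u.1) u.2 then v else v + (z (.inl (u.1, pairIndex (m u.1) u.2))).1)

/-- The bit at vertex `u` with partner colour `v`; the upper colour of a pair negates. -/
def bit (ω : OrientSeed N K) (u : N × Fin K) (v : Fin K) : Bool :=
  if IsLower (ω.1 u.1) u.2 then ω.2.2 (key ω.1 ω.2.1 u v) else !ω.2.2 (key ω.1 ω.2.1 u v)

/-- The orientation of the edge `(u, w)`: `true` selects `u`. -/
def orient (ω : OrientSeed N K) (u w : N × Fin K) : Bool :=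
  if (ω.2.1 (.inr (u, w))).2 then bit ω u w.2 else !bit ω w u.2

end OrientSeed

open OrientSeed

/-- Lower and upper colours alternate in blocks whose length is the step, so one step changes the
parity of the block. -/
lemma isLower_add_step (m : Fin 4 × Bool) (c : ℕ) (h : IsLower m c) :
    ¬ IsLower m (c + (m.1 + 1)) := by
  unfold IsLower at h ⊢
  rw [Nat.add_div_right _ (Nat.succ_pos _)]
  rw [Nat.succ_eq_add_one]
  revert h
  generalize c / ((m.1 : ℕ) + 1) = q
  intro h
  cases hm : m.2 <;> simp only [hm, reduceIte, Bool.false_eq_true] at h ⊢ <;> omega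

/-- An edge with an end `u`, the other end `w`, and `first` tells whether `u` comes first. -/
structure EdgeAt (N : Type) (K : ℕ) where
  col : Fin K
  other : N × Fin K
  first : Bool

namespace EdgeAt

variable (a : N) (e : EdgeAt N K)

/-- The edge as an ordered pair. -/
def pair : (N × Fin K) × (N × Fin K) :=
  if e.first then ((a, e.col), e.other) else (e.other, (a, e.col))

/-- The edge follows the end at `a`. -/
def Follows (z : (N × Fin (K + 4)) ⊕ ((N × Fin K) × (N × Fin K)) → Fin K × Bool) : Prop :=
  (z (.inr (e.pair a))).2 = e.first

instance (z : (N × Fin (K + 4)) ⊕ ((N × Fin K) × (N × Fin K)) → Fin K × Bool) :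
    Decidable (e.Follows a z) := by unfold Follows; infer_instance

/-- The orientation selects the end at `a`. -/
def selected (ω : OrientSeed N K) : Bool :=
  if e.first then orient ω (a, e.col) e.other else !orient ω e.other (a, e.col)

/-- The key of the bit that decides about the edge. -/
def bitKey (m : N → Fin 4 × Bool)
    (z : (N × Fin (K + 4)) ⊕ ((N × Fin K) × (N × Fin K)) → Fin K × Bool) :
    N × Fin (K + 4) × Fin K :=
  if e.Follows a z then key m z (a, e.col) e.other.2 else key m z e.other e.col

/-- The value of that bit for which the end at `a` is not selected. -/
def bitVal (m : N → Fin 4 × Bool)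
    (z : (N × Fin (K + 4)) ⊕ ((N × Fin K) × (N × Fin K)) → Fin K × Bool) : Bool :=
  if e.Follows a z then !decide (IsLower (m a) e.col) else decide (IsLower (m e.other.1) e.other.2)

/-- For fixed matching, shifts and choices of ends, losing an edge is a condition on a single fair
bit; this brings the event into the form of `expect_bits_le`. -/
lemma selected_eq_false_iff (ω : OrientSeed N K) :
    e.selected a ω = false ↔ ω.2.2 (e.bitKey a ω.1 ω.2.1) = e.bitVal a ω.1 ω.2.1 := by
  obtain ⟨c, w, f⟩ := e
  cases h : (ω.2.1 (.inr (EdgeAt.pair a ⟨c, w, f⟩))).2 <;> cases f <;>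
  by_cases h1 : IsLower (ω.1 a) c <;> by_cases h2 : IsLower (ω.1 w.1) w.2 <;>
  simp_all [selected, bitKey, bitVal, Follows, pair, orient, bit]

/-- A common key forces both edges to follow `a`, or both to follow their other ends, since keys
record the advertiser. In the first case the two distinct colours at `a` have the same pair index,
so one is lower and one upper. In the second case, if both other ends were lower or both upper,
equal keys would force equal colours at `a`. So exactly one of the two bits is negated. -/
lemma bitVal_ne {e e' : EdgeAt N K} (he : e.other.1 ≠ a) (he' : e'.other.1 ≠ a)
    (hcol : e.col ≠ e'.col) (m : N → Fin 4 × Bool)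
    (z : (N × Fin (K + 4)) ⊕ ((N × Fin K) × (N × Fin K)) → Fin K × Bool)
    (hk : e.bitKey a m z = e'.bitKey a m z) : e.bitVal a m z ≠ e'.bitVal a m z := by
  obtain ⟨c, ⟨w, d⟩, f⟩ := e
  obtain ⟨c', ⟨w', d'⟩, f'⟩ := e'
  simp only [bitKey, bitVal] at *
  have hcol' : (c : ℕ) ≠ c' := fun h => hcol (Fin.ext h)
  split_ifs at * with h1 h2 h2
  · simp only [key, Prod.mk.injEq, pairIndex, true_and] at hk
    by_cases l1 : IsLower (m a) c <;> by_cases l2 : IsLower (m a) c' <;> simp [l1, l2] at hk ⊢ <;>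
      omega
  · simp only [key, Prod.mk.injEq] at hk; exact absurd hk.1.symm he'
  · simp only [key, Prod.mk.injEq] at hk; exact absurd hk.1 he
  · simp only [key, Prod.mk.injEq] at hk
    obtain ⟨rfl, hk, hk'⟩ := hk
    rw [hk] at hk'
    by_cases l1 : IsLower (m w) d <;> by_cases l2 : IsLower (m w) d' <;> simp [l1, l2] at hk' ⊢ <;>
      exact hcol hk'

/-- A sufficient condition for a common key of two edges. -/
lemma bitKey_eq_of_matched {e e' : EdgeAt N K} (m : N → Fin 4 × Bool)
    (z : (N × Fin (K + 4)) ⊕ ((N × Fin K) × (N × Fin K)) → Fin K × Bool)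
    (hlow : IsLower (m a) e.col) (hcol : (e'.col : ℕ) = e.col + ((m a).1 + 1))
    (hf : e.Follows a z) (hf' : e'.Follows a z)
    (hz : e.other.2 = e'.other.2 + (z (.inl (a, ⟨e.col + 4, by omega⟩))).1) :
    e.bitKey a m z = e'.bitKey a m z := by
  have hlow' : ¬ IsLower (m a) e'.col := by rw [hcol]; exact isLower_add_step _ _ hlow
  have hp : (⟨e'.col + 4 - ((m a).1 + 1), by omega⟩ : Fin (K + 4)) = ⟨e.col + 4, by omega⟩ := by
    ext; simp only [hcol]; omega
  simp only [bitKey, hf, hf', if_true, key, pairIndex, hlow, hlow', if_false, hp, hz]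

lemma pair_ne {e e' : EdgeAt N K} (he : e.other.1 ≠ a) (he' : e'.other.1 ≠ a)
    (hcol : e.col ≠ e'.col) : e.pair a ≠ e'.pair a := by
  obtain ⟨c, ⟨w, d⟩, f⟩ := e
  obtain ⟨c', ⟨w', d'⟩, f'⟩ := e'
  cases f <;> cases f' <;> simp_all [pair]

end EdgeAt

/-! ### The probability that none of the edges of a point is selected -/

variable [Fintype N] [DecidableEq N] [NeZero K]

/-- Two choices of ends and one shift are three independent coordinates, with probabilities 1/2, 1/2
and 1/K. -/
lemma expect_match (i : N × Fin (K + 4)) (p p' : (N × Fin K) × (N × Fin K)) (hp : p ≠ p')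
    (b b' : Bool) (v v' : Fin K) :
    𝔼 z : (N × Fin (K + 4)) ⊕ ((N × Fin K) × (N × Fin K)) → Fin K × Bool,
      (1 - if (z (.inr p)).2 = b ∧ (z (.inr p')).2 = b' ∧ v = v' + (z (.inl i)).1
        then (1 : ℝ) else 0) = 1 - 1 / (4 * K) := by
  have hK : (K : ℝ) ≠ 0 := Nat.cast_ne_zero.2 (NeZero.ne K)
  rw [Finset.expect_sub_distrib]
  have h1 := expect_prod_coords (J := (N × Fin (K + 4)) ⊕ ((N × Fin K) × (N × Fin K)))
    (Z := Fin K × Bool) (Finset.univ : Finset (Fin 3)) ![.inr p, .inr p', .inl i]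
    (by
      intro x _ y _ h
      fin_cases x <;> fin_cases y <;> simp_all)
    ![fun x => if x.2 = b then (1 : ℝ) else 0, fun x => if x.2 = b' then (1 : ℝ) else 0,
      fun x => if v = v' + x.1 then (1 : ℝ) else 0]
  simp only [Fin.prod_univ_three, Matrix.cons_val_zero, Matrix.cons_val_one, Matrix.cons_val] at h1
  have h2 : ∀ b : Bool, 𝔼 x : Fin K × Bool, (if x.2 = b then (1 : ℝ) else 0) = 1 / 2 := by
    intro b
    rw [← Finset.univ_product_univ, Finset.expect_product]
    simp
  have h3 : 𝔼 x : Fin K × Bool, (if v = v' + x.1 then (1 : ℝ) else 0) = 1 / K := by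
    rw [← Finset.univ_product_univ, Finset.expect_product]
    have : ∀ x : Fin K, v = v' + x ↔ v - v' = x := fun x => by
      rw [sub_eq_iff_eq_add, add_comm]
    simp [this]
  rw [h2, h2, h3] at h1
  have h4 : ∀ z : (N × Fin (K + 4)) ⊕ ((N × Fin K) × (N × Fin K)) → Fin K × Bool,
      (if (z (.inr p)).2 = b ∧ (z (.inr p')).2 = b' ∧ v = v' + (z (.inl i)).1
        then (1 : ℝ) else 0) = (if (z (.inr p)).2 = b then (1 : ℝ) else 0) *
        (if (z (.inr p')).2 = b' then (1 : ℝ) else 0) *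
        (if v = v' + (z (.inl i)).1 then (1 : ℝ) else 0) := by
    intro z; split_ifs <;> simp_all
  simp only [h4, h1, Fintype.expect_const]
  field_simp
  ring

/-- The positions `l` such that the colours of the edges `l` and `l + 1` are matched. -/
def matchedAt (k : ℕ) (c : ℕ → Fin K) (m : Fin 4 × Bool) : Finset ℕ :=
  {l ∈ Finset.range (k - 1) | IsLower m (c l) ∧ (c (l + 1) : ℕ) = c l + (m.1 + 1)}

/-- The gap between consecutive colours dictates the step, and the block of the smaller colour
dictates the parity. So each consecutive pair is matched by exactly one of the eight values of `m`.
-/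
lemma sum_card_matchedAt (k : ℕ) (c : ℕ → Fin K)
    (hc : ∀ l, l + 1 < k → (c l : ℕ) < c (l + 1) ∧ (c (l + 1) : ℕ) ≤ c l + 4) :
    ∑ m, (matchedAt k c m).card = k - 1 := by
  simp only [matchedAt, Finset.card_filter]
  rw [Finset.sum_comm]
  have : ∀ l ∈ Finset.range (k - 1), ∑ m : Fin 4 × Bool,
      (if IsLower m (c l) ∧ (c (l + 1) : ℕ) = c l + (m.1 + 1) then 1 else 0) = 1 := by
    intro l hl
    obtain ⟨h1, h2⟩ := hc l (by have := Finset.mem_range.1 hl; omega)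
    set d : Fin 4 := ⟨c (l + 1) - c l - 1, by omega⟩ with hd
    rw [Finset.sum_eq_single (d, decide ((c l / ((d : ℕ) + 1)) % 2 = 1))]
    · rw [if_pos]
      refine ⟨?_, by simp only [hd]; omega⟩
      unfold IsLower
      simp only [decide_eq_true_eq]
      split_ifs <;> omega
    · rintro ⟨d', b⟩ _ hne
      rw [if_neg]
      rintro ⟨h3, h4⟩
      apply hne
      have hd' : d' = d := by ext; simp only [hd] at *; omega
      subst hd'
      unfold IsLower at h3
      simp only [Prod.mk.injEq, true_and]
      cases b <;> simp_all
    · simp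
  rw [Finset.sum_congr rfl this]; simp

/-- Never selecting the end at `a` has a small probability. -/
theorem expect_never_selected_le (a : N) (k : ℕ) (hk : 1 ≤ k) (hkK : 2 * (k - 1) ≤ K)
    (e : ℕ → EdgeAt N K) (ho : ∀ l < k, (e l).other.1 ≠ a)
    (hc : ∀ l, l + 1 < k → ((e l).col : ℕ) < (e (l + 1)).col ∧
      ((e (l + 1)).col : ℕ) ≤ (e l).col + 4) :
    𝔼 ω : OrientSeed N K, (if ∀ l ∈ Finset.range k, (e l).selected a ω = false then (1 : ℝ) else 0)
      ≤ (1 / 2) ^ k * (1 - (k - 1) / (36 * K)) := by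
  have hK : (0 : ℝ) < K := Nat.cast_pos.2 (NeZero.pos K)
  have hcol : ∀ l < k, ∀ l' < k, l < l' → ((e l).col : ℕ) < (e l').col := by
    intro l hl l' hl' h
    induction l', h using Nat.le_induction with
    | base => exact (hc l hl').1
    | succ n hn ih => exact (ih (by omega)).trans (hc n hl').1
  have hne : ∀ l < k, ∀ l' < k, l ≠ l' → (e l).col ≠ (e l').col := by
    intro l hl l' hl' h he
    rcases lt_or_gt_of_ne h with h | h
    · exact absurd (congrArg Fin.val he) (hcol l hl l' hl' h).ne
    · exact absurd (congrArg Fin.val he) (hcol l' hl' l hl h).ne'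
  set Λ := matchedAt k (fun l => (e l).col) with hΛ
  have hmem : ∀ m l, l ∈ Λ m → l + 1 < k ∧ IsLower m (e l).col ∧
      ((e (l + 1)).col : ℕ) = (e l).col + (m.1 + 1) := by
    intro m l hl
    simp only [hΛ, matchedAt, Finset.mem_filter, Finset.mem_range] at hl
    exact ⟨by omega, hl.2⟩
  let E : ℕ → ((N × Fin (K + 4)) ⊕ ((N × Fin K) × (N × Fin K)) → Fin K × Bool) → Prop :=
    fun l z => (z (.inr ((e l).pair a))).2 = (e l).first ∧
      (z (.inr ((e (l + 1)).pair a))).2 = (e (l + 1)).first ∧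
      (e l).other.2 = (e (l + 1)).other.2 + (z (.inl (a, ⟨(e l).col + 4, by omega⟩))).1
  classical
  -- Averaging over the bits alone: the factor is 2^(-k) in general, and 0 as soon as one matched
  -- pair of edges reads the same bit.
  have hy : ∀ m z, 𝔼 y : N × Fin (K + 4) × Fin K → Bool,
      (if ∀ l ∈ Finset.range k, (e l).selected a (m, z, y) = false then (1 : ℝ) else 0) ≤
      (1 / 2) ^ k * ∏ l ∈ Λ (m a), (1 - if E l z then (1 : ℝ) else 0) := by
    intro m z
    simp only [EdgeAt.selected_eq_false_iff]
    have h := expect_bits_le (Finset.range k) (fun l => (e l).bitKey a m z)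
      (fun l => (e l).bitVal a m z) (fun l hl l' hl' hll' => by
        have hl := Finset.mem_range.1 hl
        have hl' := Finset.mem_range.1 hl'
        exact EdgeAt.bitVal_ne a (ho l hl) (ho l' hl') (hne l hl l' hl' hll') m z)
    rw [Finset.card_range] at h
    by_cases hE : ∃ l ∈ Λ (m a), E l z
    · obtain ⟨l, hl, hEl⟩ := hE
      obtain ⟨h1, h2, h3⟩ := hmem _ _ hl
      rw [h.2, Finset.prod_eq_zero hl (by simp [hEl]), mul_zero]
      intro hinj
      have := hinj (Finset.mem_coe.2 (Finset.mem_range.2 (by omega : l < k)))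
        (Finset.mem_coe.2 (Finset.mem_range.2 h1))
        (EdgeAt.bitKey_eq_of_matched a m z h2 h3 hEl.1 hEl.2.1 hEl.2.2)
      omega
    · push Not at hE
      rw [Finset.prod_congr rfl fun l hl => by rw [if_neg (hE l hl)]]
      simpa using h.1
  have hz : ∀ m : Fin 4 × Bool, 𝔼 z, ∏ l ∈ Λ m, (1 - if E l z then (1 : ℝ) else 0) =
      (1 - 1 / (4 * K)) ^ (Λ m).card := by
    intro m
    rw [expect_prod_eq_of_disjoint_coords (Λ m) (fun l => {.inl (a, ⟨(e l).col + 4, by omega⟩),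
      .inr ((e l).pair a), .inr ((e (l + 1)).pair a)}) (fun l z => 1 - if E l z then (1 : ℝ) else 0)]
    · rw [Finset.prod_congr rfl fun l hl => ?_, Finset.prod_const]
      obtain ⟨h1, -, -⟩ := hmem _ _ hl
      exact expect_match _ _ _
        (EdgeAt.pair_ne a (ho l (by omega)) (ho _ h1) (hne l (by omega) _ h1 (by omega))) _ _ _ _
    · intro l hl l' hl' hll'
      obtain ⟨h1, h2, h3⟩ := hmem _ _ hl
      obtain ⟨h1', h2', h3'⟩ := hmem _ _ hl'
      -- Matched positions are never adjacent, because the colour that ends one match is upper and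
      -- cannot start another. Hence the events depend on disjoint coordinates and are independent.
      have hn : l + 1 ≠ l' := by
        rintro rfl; rw [h3] at h2'; exact isLower_add_step _ _ h2 h2'
      have hn' : l ≠ l' + 1 := by
        rintro rfl; rw [h3'] at h2; exact isLower_add_step _ _ h2' h2
      have hp : ∀ i < k, ∀ j < k, i ≠ j → (e i).pair a ≠ (e j).pair a := fun i hi j hj hij =>
        EdgeAt.pair_ne a (ho i hi) (ho j hj) (hne i hi j hj hij)
      have hcl : ((e l).col : ℕ) ≠ (e l').col :=
        fun h => hne l (by omega) l' (by omega) hll' (Fin.ext h)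
      have p1 := hp l (by omega) l' (by omega) hll'
      have p2 := hp l (by omega) (l' + 1) (by omega) hn'
      have p3 := hp (l + 1) (by omega) l' (by omega) hn
      have p4 := hp (l + 1) (by omega) (l' + 1) (by omega) (by omega)
      simp [p1.symm, p2.symm, p3.symm, p4.symm, hcl.symm]
    · intro l _ z z' h
      have q1 := h _ (Or.inl rfl)
      have q2 := h _ (Or.inr (Or.inl rfl))
      have q3 := h _ (Or.inr (Or.inr rfl))
      simp only [E, q1, q2, q3]
  -- With u = n / (4K) ≤ 1/8, the power is at most 1 / (1 + u) ≤ 1 - 8/9 u. The linear bound depends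
  -- on the matching only through the number of matched positions, whose sum is known.
  have hx : ∀ n ≤ k - 1, (1 - 1 / (4 * (K : ℝ))) ^ n ≤ 1 - 8 / 9 * (n / (4 * K)) := by
    intro n hn
    set x : ℝ := 1 / (4 * (K : ℝ)) with hx
    have hx0 : 0 ≤ x := by positivity
    have hK1 : (1 : ℝ) ≤ K := by exact_mod_cast NeZero.pos K
    have hx1 : x ≤ 1 := by
      rw [hx, div_le_one (by positivity)]; linarith
    have hnx : n * x ≤ 1 / 8 := by
      have : 2 * (n : ℝ) ≤ K := by exact_mod_cast (by omega : 2 * n ≤ K)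
      rw [hx, mul_one_div, div_le_iff₀ (by positivity)]; linarith
    have h1 : 1 + n * x ≤ (1 + x) ^ n := one_add_mul_le_pow (by linarith) n
    have h2 : (1 - x) ^ n * (1 + x) ^ n ≤ 1 := by
      rw [← mul_pow]; apply pow_le_one₀ <;> nlinarith
    have h3 : (1 - x) ^ n * (1 + n * x) ≤ 1 :=
      (mul_le_mul_of_nonneg_left h1 (pow_nonneg (by linarith) n)).trans h2
    have hnx0 : 0 ≤ n * x := by positivity
    have h4 : (n : ℝ) / (4 * K) = n * x := by rw [hx]; ring
    rw [h4]
    have : 0 ≤ (1 - x) ^ n := pow_nonneg (by linarith) n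
    by_contra hcon
    push Not at hcon
    nlinarith
  calc 𝔼 ω : OrientSeed N K,
        (if ∀ l ∈ Finset.range k, (e l).selected a ω = false then (1 : ℝ) else 0)
      = 𝔼 m : N → Fin 4 × Bool,
        𝔼 z : (N × Fin (K + 4)) ⊕ ((N × Fin K) × (N × Fin K)) → Fin K × Bool,
        𝔼 y : N × Fin (K + 4) × Fin K → Bool,
        (if ∀ l ∈ Finset.range k, (e l).selected a (m, z, y) = false then (1 : ℝ) else 0) := by
        rw [← Finset.univ_product_univ, Finset.expect_product]
        refine Finset.expect_congr rfl fun m _ => ?_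
        rw [← Finset.univ_product_univ, Finset.expect_product]
    _ ≤ 𝔼 m : N → Fin 4 × Bool, (1 / 2) ^ k * (1 - 1 / (4 * (K : ℝ))) ^ (Λ (m a)).card := by
        refine Finset.expect_le_expect fun m _ => ?_
        rw [← hz, Finset.mul_expect]
        exact Finset.expect_le_expect fun z _ => hy m z
    _ = (1 / 2) ^ k * 𝔼 m : Fin 4 × Bool, (1 - 1 / (4 * (K : ℝ))) ^ (Λ m).card := by
        rw [← Finset.mul_expect,
          expect_coord a fun m : Fin 4 × Bool => (1 - 1 / (4 * (K : ℝ))) ^ (Λ m).card]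
    _ ≤ (1 / 2) ^ k * 𝔼 m : Fin 4 × Bool, (1 - 8 / 9 * ((Λ m).card / (4 * (K : ℝ)))) := by
        refine mul_le_mul_of_nonneg_left (Finset.expect_le_expect fun m _ => hx _ ?_) (by positivity)
        refine (Finset.card_filter_le _ _).trans ?_
        simp
    _ = (1 / 2) ^ k * (1 - (k - 1) / (36 * K)) := by
        have hs := sum_card_matchedAt k (fun l => (e l).col) hc
        have hs' : ∑ m, ((Λ m).card : ℝ) = k - 1 := by
          rw [← Nat.cast_sum, hs]; push_cast [hk]; ring
        congr 1
        rw [Fintype.expect_eq_sum_div_card, Finset.sum_sub_distrib, ← Finset.mul_sum,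
          ← Finset.sum_div, hs']
        simp
        field_simp
        ring

end Orientation

open OrientSeed

/-! ## Invariants of the panoramic interval-level assignment -/

lemma scanLength_nonneg (β : ℝ) (D : Set ℝ) (y b : ℝ) : 0 ≤ scanLength β D y b :=
  Real.sSup_nonneg fun _ ht => ht.1.1

lemma scanLength_le {β : ℝ} (hβ : 0 ≤ β) (D : Set ℝ) (y b : ℝ) : scanLength β D y b ≤ β :=
  Real.sSup_le (fun _ ht => ht.1.2) hβ

lemma circAdd_mem {β : ℝ} (hβ : 0 < β) (D : Set ℝ) {y : ℝ} (hy : y ∈ Ico 0 β) (b : ℝ) :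
    circAdd β D y b ∈ Ico 0 β := by
  have h1 := scanLength_nonneg β D y b
  have h2 := scanLength_le hβ.le D y b
  unfold circAdd
  split_ifs with h
  · exact ⟨by linarith [hy.1], h⟩
  · exact ⟨by linarith, by linarith [hy.2]⟩

lemma scanSet_subset (β : ℝ) (D : Set ℝ) (y b : ℝ) : scanSet β D y b ⊆ Ico 0 β \ D :=
  fun _ hz => ⟨hz.1.1, hz.2⟩

lemma mem_scanSet_iff {β : ℝ} {D : Set ℝ} {p b y : ℝ} (hy : y ∈ Ico 0 β) (hD : y ∉ D) :
    y ∈ scanSet β D p b ↔ (if p ≤ y then y - p else y - p + β) < scanLength β D p b := by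
  simp [scanSet, circArc, circOffset, hD, hy.1, hy.2]

/-- The points outside of `D` have been visited `n` times, and those below the pointer `p` once
more. -/
def IsLevel (β : ℝ) (D : Set ℝ) (p : ℝ) (c : ℝ → ℕ) : Prop :=
  ∃ n, ∀ y ∈ Ico 0 β, y ∉ D → c y = if y < p then n + 1 else n

lemma IsLevel.le_add_one {β : ℝ} {D : Set ℝ} {p : ℝ} {c : ℝ → ℕ} (h : IsLevel β D p c) {y z : ℝ}
    (hy : y ∈ Ico 0 β \ D) (hz : z ∈ Ico 0 β \ D) : c y ≤ c z + 1 := by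
  obtain ⟨n, h⟩ := h
  rw [h y hy.1 hy.2, h z hz.1 hz.2]
  split_ifs <;> omega

/-- The scan starts at the pointer, where the points of lower count begin, and reaches points below
the pointer only after all of those. -/
lemma IsLevel.le_of_mem_scanSet {β : ℝ} {D : Set ℝ} {p : ℝ} {c : ℝ → ℕ} (h : IsLevel β D p c)
    {b y z : ℝ} (hy : y ∈ scanSet β D p b) (hz : z ∈ Ico 0 β \ D) (hz' : z ∉ scanSet β D p b) :
    c y ≤ c z := by
  obtain ⟨n, h⟩ := h
  have hyD := scanSet_subset _ _ _ _ hy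
  rw [mem_scanSet_iff hyD.1 hyD.2] at hy
  rw [mem_scanSet_iff hz.1 hz.2] at hz'
  rw [h y hyD.1 hyD.2, h z hz.1 hz.2]
  have := hyD.1.1
  have := hz.1.2
  split_ifs at * <;> first | omega | (exfalso; linarith)

/-- The level rises by one exactly when the pointer wraps around. Both kinds of rounds are covered:
in a deterministic one the scanned points lie in `D'`, and `hin` is vacuous. -/
lemma IsLevel.next {β : ℝ} (hβ : 0 < β) {D D' : Set ℝ} {p b : ℝ} {c c' : ℝ → ℕ}
    (hp : p ∈ Ico 0 β) (h : IsLevel β D p c) (hD : D ⊆ D')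
    (hin : ∀ y ∈ scanSet β D p b, y ∉ D' → c' y = c y + 1)
    (hout : ∀ y ∉ scanSet β D p b, y ∉ D' → c' y = c y) :
    IsLevel β D' (circAdd β D p b) c' := by
  obtain ⟨n, h⟩ := h
  have h1 := scanLength_nonneg β D p b
  have h2 := scanLength_le hβ.le D p b
  obtain ⟨hp1, hp2⟩ := hp
  unfold circAdd
  split_ifs with hs
  · refine ⟨n, fun y hy hyD => ?_⟩
    have hyD' : y ∉ D := fun h => hyD (hD h)
    have hc := h y hy hyD'
    have hm := mem_scanSet_iff (p := p) (b := b) hy hyD'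
    obtain ⟨hy1, hy2⟩ := hy
    by_cases hy : y ∈ scanSet β D p b
    · rw [hin y hy hyD, hc]
      rw [hm] at hy
      split_ifs at * <;> first | omega | (exfalso; linarith)
    · rw [hout y hy hyD, hc]
      rw [hm] at hy
      split_ifs at * <;> first | omega | (exfalso; linarith)
  · refine ⟨n + 1, fun y hy hyD => ?_⟩
    have hyD' : y ∉ D := fun h => hyD (hD h)
    have hc := h y hy hyD'
    have hm := mem_scanSet_iff (p := p) (b := b) hy hyD'
    obtain ⟨hy1, hy2⟩ := hy
    by_cases hy : y ∈ scanSet β D p b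
    · rw [hin y hy hyD, hc]
      rw [hm] at hy
      split_ifs at * <;> first | omega | (exfalso; linarith)
    · rw [hout y hy hyD, hc]
      rw [hm] at hy
      split_ifs at * <;> first | omega | (exfalso; linarith)

/-! ### Traces: the history of one advertiser -/

/-- The history of one advertiser: numbers of semi-assignments, points assigned in deterministic
rounds, and the sets that are semi-assigned respectively assigned at each time. -/
structure Trace (β : ℝ) where
  cnt : ℕ → ℝ → ℕ
  det : ℕ → Set ℝ
  semi : ℕ → Set ℝ
  fix : ℕ → Set ℝ
  cnt_zero : ∀ y, cnt 0 y = 0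
  det_zero : det 0 = ∅
  cnt_succ_of_mem : ∀ t, ∀ y ∈ semi t, cnt (t + 1) y = cnt t y + 1
  cnt_succ_of_notMem : ∀ t, ∀ y ∉ semi t, cnt (t + 1) y = cnt t y
  det_succ : ∀ t, det (t + 1) = det t ∪ fix t
  semi_subset : ∀ t, semi t ⊆ Ico 0 β \ det t
  fix_subset : ∀ t, fix t ⊆ Ico 0 β \ det t
  disjoint_semi_fix : ∀ t, ∀ y ∈ semi t, y ∉ fix t
  spread : ∀ t, ∀ y ∈ Ico 0 β \ det t, ∀ z ∈ Ico 0 β \ det t, cnt t y ≤ cnt t z + 1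
  lowest_semi : ∀ t, ∀ y ∈ semi t, ∀ z ∈ Ico 0 β \ det t, z ∉ semi t → cnt t y ≤ cnt t z
  lowest_fix : ∀ t, ∀ y ∈ fix t, ∀ z ∈ Ico 0 β \ det t, z ∉ fix t → cnt t y ≤ cnt t z

/-- The colour of a set `S` of points with counts `c`: twice the least count, plus one if the count
is not constant on `S`. -/
def setColor (c : ℝ → ℕ) (S : Set ℝ) : ℕ :=
  open Classical in
  if ∃ z ∈ S, c z ≠ sInf (c '' S) then 2 * sInf (c '' S) + 1 else 2 * sInf (c '' S)

lemma setColor_spec {c : ℝ → ℕ} {S : Set ℝ} (hS : S.Nonempty)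
    (h : ∀ y ∈ S, ∀ z ∈ S, c y ≤ c z + 1) :
    ∃ m, (∃ z ∈ S, c z = m) ∧ (∀ z ∈ S, m ≤ c z ∧ c z ≤ m + 1) ∧
      ((setColor c S = 2 * m ∧ ∀ z ∈ S, c z = m) ∨
        (setColor c S = 2 * m + 1 ∧ ∃ z ∈ S, c z = m + 1)) := by
  obtain ⟨z₀, hz₀, hm⟩ : sInf (c '' S) ∈ c '' S := Nat.sInf_mem (hS.image c)
  have hb : ∀ z ∈ S, sInf (c '' S) ≤ c z ∧ c z ≤ sInf (c '' S) + 1 := fun z hz =>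
    ⟨Nat.sInf_le ⟨z, hz, rfl⟩, by rw [← hm]; exact h z hz z₀ hz₀⟩
  refine ⟨sInf (c '' S), ⟨z₀, hz₀, hm⟩, hb, ?_⟩
  unfold setColor
  split_ifs with hex
  · obtain ⟨z, hz, hne⟩ := hex
    have := hb z hz
    exact Or.inr ⟨rfl, z, hz, by omega⟩
  · push Not at hex
    exact Or.inl ⟨rfl, hex⟩

namespace Trace

variable {β : ℝ} (τ : Trace β)

lemma cnt_le_succ (t : ℕ) (y : ℝ) : τ.cnt t y ≤ τ.cnt (t + 1) y := by
  by_cases h : y ∈ τ.semi t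
  · rw [τ.cnt_succ_of_mem t y h]; omega
  · rw [τ.cnt_succ_of_notMem t y h]

lemma cnt_mono (y : ℝ) : Monotone fun t => τ.cnt t y :=
  monotone_nat_of_le_succ fun t => τ.cnt_le_succ t y

lemma det_mono : Monotone τ.det :=
  monotone_nat_of_le_succ fun t => by rw [τ.det_succ]; exact subset_union_left

lemma cnt_lt_of_mem_semi {i j : ℕ} (hij : i < j) {y : ℝ} (hy : y ∈ τ.semi i) :
    τ.cnt i y + 1 ≤ τ.cnt j y := by
  rw [← τ.cnt_succ_of_mem i y hy]; exact τ.cnt_mono y hij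

/-- If `z` is scanned at time `j` too, its increment makes up for the spread of one; otherwise `y`
was scanned before it for having no larger count. -/
lemma cnt_le_of_mem_semi {j n : ℕ} (hjn : j < n) {y z : ℝ} (hy : y ∈ τ.semi j)
    (hz : z ∈ Ico 0 β \ τ.det n) : τ.cnt j y ≤ τ.cnt n z := by
  have hzj : z ∈ Ico 0 β \ τ.det j := ⟨hz.1, fun h => hz.2 (τ.det_mono hjn.le h)⟩
  by_cases h : z ∈ τ.semi j
  · exact (τ.spread j y (τ.semi_subset j hy) z hzj).trans (τ.cnt_lt_of_mem_semi hjn h)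
  · exact (τ.lowest_semi j y hy z hzj h).trans (τ.cnt_mono z hjn.le)

lemma cnt_le_of_mem_fix {j n : ℕ} (hjn : j < n) {y z : ℝ} (hy : y ∈ τ.fix j)
    (hz : z ∈ Ico 0 β \ τ.det n) : τ.cnt j y ≤ τ.cnt n z := by
  have hzj : z ∉ τ.det (j + 1) := fun h => hz.2 (τ.det_mono hjn h)
  rw [τ.det_succ] at hzj
  exact (τ.lowest_fix j y hy z ⟨hz.1, fun h => hzj (Or.inl h)⟩ fun h => hzj (Or.inr h)).trans
    (τ.cnt_mono z hjn.le)

lemma exists_mem_fix_of_mem_det {n : ℕ} {y : ℝ} (hy : y ∈ τ.det n) : ∃ j < n, y ∈ τ.fix j := by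
  induction n with
  | zero => rw [τ.det_zero] at hy; exact absurd hy (notMem_empty y)
  | succ n ih =>
    rw [τ.det_succ] at hy
    rcases hy with hy | hy
    · obtain ⟨j, hj, h⟩ := ih hy
      exact ⟨j, by omega, h⟩
    · exact ⟨n, by omega, hy⟩

/-- The colours of two consecutive rounds in which a point is semi-assigned. -/
lemma setColor_lt {i j : ℕ} (hij : i < j) {y : ℝ} (hi : y ∈ τ.semi i) (hj : y ∈ τ.semi j)
    (hc : τ.cnt j y = τ.cnt i y + 1) :
    setColor (τ.cnt i) (τ.semi i) < setColor (τ.cnt j) (τ.semi j) ∧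
      setColor (τ.cnt j) (τ.semi j) ≤ setColor (τ.cnt i) (τ.semi i) + 4 := by
  obtain ⟨m, -, hb, hm⟩ := setColor_spec ⟨y, hi⟩ fun y hy z hz =>
    τ.spread i y (τ.semi_subset i hy) z (τ.semi_subset i hz)
  obtain ⟨m', ⟨z, hz, hzm⟩, hb', hm'⟩ := setColor_spec ⟨y, hj⟩ fun y hy z hz =>
    τ.spread j y (τ.semi_subset j hy) z (τ.semi_subset j hz)
  have h1 := hb y hi
  have h2 := hb' y hj
  rcases hm with ⟨hm, hall⟩ | ⟨hm, z', hz', hzm'⟩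
  · have := hall y hi
    rcases hm' with ⟨hm', hall'⟩ | ⟨hm', -⟩
    · have := hall' y hj; omega
    · omega
  · rcases hm' with ⟨hm', hall'⟩ | ⟨hm', -⟩
    · have := hall' y hj; omega
    -- Only two mixed sets with the same minimum could share a colour. A minimal point of the later
    -- set would have been missed by the earlier scan although that scan took points of larger
    -- count.
    · have hne : m ≠ m' := by
        rintro rfl
        have hzi : z ∈ Ico 0 β \ τ.det i :=
          ⟨(τ.semi_subset j hz).1, fun h => (τ.semi_subset j hz).2 (τ.det_mono hij.le h)⟩
        by_cases h : z ∈ τ.semi i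
        · have := τ.cnt_lt_of_mem_semi hij h
          have := (hb z h).1
          omega
        · have := τ.lowest_semi i z' hz' z hzi h
          have : τ.cnt i z ≤ τ.cnt j z := τ.cnt_mono z hij.le
          omega
      omega

/-- The largest possible colour 2k - 2 belongs to an unmixed set of count k - 1; a mixed set needs a
point of count at most k - 1 above its minimum. -/
lemma setColor_lt_of_cnt_le {i k : ℕ} {y : ℝ} (hi : y ∈ τ.semi i)
    (hk : ∀ z ∈ Ico 0 β, τ.cnt (i + 1) z ≤ k) :
    setColor (τ.cnt i) (τ.semi i) < 2 * k - 1 := by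
  obtain ⟨m, ⟨z, hz, hzm⟩, hb, hm⟩ := setColor_spec ⟨y, hi⟩ fun y hy z hz =>
    τ.spread i y (τ.semi_subset i hy) z (τ.semi_subset i hz)
  have h1 := hk z (τ.semi_subset i hz).1
  rw [τ.cnt_succ_of_mem i z hz] at h1
  rcases hm with ⟨hm, -⟩ | ⟨hm, z', hz', hzm'⟩
  · omega
  · have h2 := hk z' (τ.semi_subset i hz').1
    rw [τ.cnt_succ_of_mem i z' hz'] at h2
    omega

lemma exists_semi_of_lt_cnt {n m : ℕ} {y : ℝ} (hm : m < τ.cnt n y) :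
    ∃ t < n, y ∈ τ.semi t ∧ τ.cnt t y = m := by
  induction n with
  | zero => rw [τ.cnt_zero] at hm; omega
  | succ n ih =>
    by_cases h : m < τ.cnt n y
    · obtain ⟨t, ht, h⟩ := ih h
      exact ⟨t, by omega, h⟩
    · by_cases hy : y ∈ τ.semi n
      · rw [τ.cnt_succ_of_mem n y hy] at hm
        exact ⟨n, by omega, hy, by omega⟩
      · rw [τ.cnt_succ_of_notMem n y hy] at hm
        omega

end Trace

/-! ### The trace of an advertiser in the panoramic assignment -/

section PanTrace

variable {A : Type*} [DecidableEq A] (B : A → ℝ)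

/-- The state after a list of rounds. -/
def stateAfter (R : List (Round A)) : PanState A :=
  R.foldl (fun s r => s.next B r) ⟨fun _ => 0, fun _ => ∅⟩

lemma stateAfter_append_singleton (R : List (Round A)) (r : Round A) :
    stateAfter B (R ++ [r]) = (stateAfter B R).next B r := by
  simp [stateAfter]

lemma stepsFrom_append_singleton (s : PanState A) (R : List (Round A)) (r : Round A) :
    stepsFrom B s (R ++ [r]) =
      stepsFrom B s R ++ [(R.foldl (fun s r => s.next B r) s).step B r] := by
  induction R generalizing s with
  | nil => rfl
  | cons q R ih => simp [stepsFrom, ih]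

lemma panoramicSteps_append_singleton (R : List (Round A)) (r : Round A) :
    panoramicSteps B (R ++ [r]) = panoramicSteps B R ++ [(stateAfter B R).step B r] :=
  stepsFrom_append_singleton B _ R r

lemma length_stepsFrom (s : PanState A) (R : List (Round A)) :
    (stepsFrom B s R).length = R.length := by
  induction R generalizing s with
  | nil => rfl
  | cons q R ih => simp [stepsFrom, ih]

lemma length_panoramicSteps (R : List (Round A)) : (panoramicSteps B R).length = R.length :=
  length_stepsFrom B _ R

lemma take_panoramicSteps (R : List (Round A)) (t : ℕ) :
    (panoramicSteps B R).take t = panoramicSteps B (R.take t) := by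
  unfold panoramicSteps
  generalize (⟨fun _ => 0, fun _ => ∅⟩ : PanState A) = s
  induction R generalizing s t with
  | nil => simp [stepsFrom]
  | cons q R ih => cases t <;> simp [stepsFrom, ih]

lemma take_succ_eq {α : Type*} (R : List α) {t : ℕ} (ht : t < R.length) :
    R.take (t + 1) = R.take t ++ [R[t]] := by
  simp

lemma getElem_panoramicSteps (R : List (Round A)) {t : ℕ} (ht : t < R.length) :
    (panoramicSteps B R)[t]'(by rw [length_panoramicSteps]; exact ht) =
      (stateAfter B (R.take t)).step B R[t] := by
  have h := take_panoramicSteps B R (t + 1)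
  rw [take_succ_eq _ ht, panoramicSteps_append_singleton, ← take_panoramicSteps,
    take_succ_eq _ (by rw [length_panoramicSteps]; exact ht)] at h
  exact List.singleton_injective (List.append_cancel_left h)

lemma semiCount_append_singleton (T : List (Step A)) (s : Step A) (a : A) (y : ℝ) :
    semiCount (T ++ [s]) a y = semiCount T a y +
      open Classical in if s.SemiAssigns a y then 1 else 0 := by
  simp only [semiCount, List.countP_append, List.countP_singleton]
  by_cases h : s.SemiAssigns a y <;> simp [h]

/-- What a valid round means for an advertiser. -/
lemma round_cases (s : PanState A) {r : Round A} (hr : r.Valid B) (a : A) :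
    ((∀ y, ¬ (s.step B r).SemiAssigns a y) ∧ (∀ y, ¬ (s.step B r).Assigns a y) ∧
      (s.next B r).start a = s.start a ∧ (s.next B r).assigned a = s.assigned a) ∨
    (∃ b, (0 ≤ b ∧ b ≤ B a) ∧ (∀ y, (s.step B r).SemiAssigns a y ↔ y ∈ s.nextSet B a b) ∧
      (∀ y, ¬ (s.step B r).Assigns a y) ∧
      (s.next B r).start a = s.nextStart B a b ∧ (s.next B r).assigned a = s.assigned a) ∨
    (∃ b, (0 ≤ b ∧ b ≤ B a) ∧ (∀ y, ¬ (s.step B r).SemiAssigns a y) ∧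
      (∀ y, (s.step B r).Assigns a y ↔ y ∈ s.nextSet B a b) ∧
      (s.next B r).start a = s.nextStart B a b ∧
      (s.next B r).assigned a = s.assigned a ∪ s.nextSet B a b) := by
  cases r with
  | det a' b =>
    by_cases h : a' = a
    · subst h
      right; right
      exact ⟨b, hr, by simp [PanState.step, Step.SemiAssigns],
        by simp [PanState.step, Step.Assigns], by simp [PanState.next], by simp [PanState.next]⟩
    · left
      simp [PanState.step, Step.SemiAssigns, Step.Assigns, PanState.next, h, Ne.symm h]
  | rand a₁ b₁ a₂ b₂ =>
    obtain ⟨hne, h1, h2⟩ := hr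
    by_cases e1 : a₁ = a
    · subst e1
      right; left
      exact ⟨b₁, h1, by simp [PanState.step, Step.SemiAssigns, hne.symm],
        by simp [PanState.step, Step.Assigns], by simp [PanState.next, hne],
        by simp [PanState.next]⟩
    · by_cases e2 : a₂ = a
      · subst e2
        right; left
        exact ⟨b₂, h2, by simp [PanState.step, Step.SemiAssigns, e1],
          by simp [PanState.step, Step.Assigns], by simp [PanState.next],
          by simp [PanState.next]⟩
      · left
        simp [PanState.step, Step.SemiAssigns, Step.Assigns, PanState.next, e1, e2, Ne.symm e1,
          Ne.symm e2]

/-- Pointers stay in range, and the counts are level. -/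
lemma isLevel_stateAfter (hB : ∀ a, 0 < B a) (a : A) (R : List (Round A))
    (hR : ∀ r ∈ R, r.Valid B) :
    (stateAfter B R).start a ∈ Ico 0 (B a) ∧
      IsLevel (B a) ((stateAfter B R).assigned a) ((stateAfter B R).start a)
        (semiCount (panoramicSteps B R) a) := by
  induction R using List.reverseRecOn with
  | nil =>
    refine ⟨⟨le_rfl, hB a⟩, 0, fun y hy _ => ?_⟩
    have h0 : (stateAfter B []).start a = 0 := rfl
    rw [h0, if_neg (not_lt.2 hy.1)]
    rfl
  | append_singleton R r ih =>
    obtain ⟨ih1, ih2⟩ := ih fun q hq => hR q (by simp [hq])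
    rw [stateAfter_append_singleton, panoramicSteps_append_singleton]
    rcases round_cases B (stateAfter B R) (hR r (by simp)) a with
      ⟨h1, -, h3, h4⟩ | ⟨b, -, h1, -, h3, h4⟩ | ⟨b, -, h1, -, h3, h4⟩
    · rw [h3, h4]
      refine ⟨ih1, ?_⟩
      obtain ⟨n, ih2⟩ := ih2
      exact ⟨n, fun y hy hD => by simp [semiCount_append_singleton, h1, ih2 y hy hD]⟩
    · rw [h3, h4]
      refine ⟨circAdd_mem (hB a) _ ih1 b, ih2.next (hB a) ih1 subset_rfl ?_ ?_⟩
      · intro y hy _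
        rw [semiCount_append_singleton, if_pos ((h1 y).2 hy)]
      · intro y hy _
        rw [semiCount_append_singleton, if_neg fun h => hy ((h1 y).1 h), add_zero]
    · rw [h3, h4]
      refine ⟨circAdd_mem (hB a) _ ih1 b, ih2.next (hB a) ih1 subset_union_left ?_ ?_⟩
      · intro y hy hy'
        exact absurd (Or.inr hy) hy'
      · intro y hy _
        rw [semiCount_append_singleton, if_neg (h1 y), add_zero]

/-- The trace of advertiser `a` when the rounds are `R`. -/
def panTrace (hB : ∀ a, 0 < B a) (R : List (Round A)) (hR : ∀ r ∈ R, r.Valid B) (a : A) :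
    Trace (B a) where
  cnt t := semiCount (panoramicSteps B (R.take t)) a
  det t := (stateAfter B (R.take t)).assigned a
  semi t := {y | ∃ h : t < R.length, ((stateAfter B (R.take t)).step B R[t]).SemiAssigns a y}
  fix t := {y | ∃ h : t < R.length, ((stateAfter B (R.take t)).step B R[t]).Assigns a y}
  cnt_zero y := by simp [panoramicSteps, stepsFrom, semiCount]
  det_zero := by simp [stateAfter]
  cnt_succ_of_mem t y hy := by
    obtain ⟨ht, hy⟩ := hy
    rw [take_succ_eq R ht, panoramicSteps_append_singleton, semiCount_append_singleton, if_pos hy]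
  cnt_succ_of_notMem t y hy := by
    by_cases ht : t < R.length
    · rw [take_succ_eq R ht, panoramicSteps_append_singleton, semiCount_append_singleton,
        if_neg fun h => hy ⟨ht, h⟩, add_zero]
    · rw [List.take_of_length_le (by omega), List.take_of_length_le (by omega)]
  det_succ t := by
    by_cases ht : t < R.length
    · rw [take_succ_eq R ht, stateAfter_append_singleton]
      rcases round_cases B (stateAfter B (R.take t)) (hR _ (R.getElem_mem ht)) a with
        ⟨-, h2, -, h4⟩ | ⟨b, -, -, h2, -, h4⟩ | ⟨b, -, -, h2, -, h4⟩
      · simp [h2, h4]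
      · simp [h2, h4]
      · simp [h2, h4, ht]
    · rw [List.take_of_length_le (by omega), List.take_of_length_le (by omega)]
      simp [ht]
  semi_subset t y hy := by
    obtain ⟨ht, hy⟩ := hy
    rcases round_cases B (stateAfter B (R.take t)) (hR _ (R.getElem_mem ht)) a with
      ⟨h1, -⟩ | ⟨b, -, h1, -⟩ | ⟨b, -, h1, -⟩
    · exact absurd hy (h1 y)
    · exact scanSet_subset _ _ _ _ ((h1 y).1 hy)
    · exact absurd hy (h1 y)
  fix_subset t y hy := by
    obtain ⟨ht, hy⟩ := hy
    rcases round_cases B (stateAfter B (R.take t)) (hR _ (R.getElem_mem ht)) a with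
      ⟨-, h1, -⟩ | ⟨b, -, -, h1, -⟩ | ⟨b, -, -, h1, -⟩
    · exact absurd hy (h1 y)
    · exact absurd hy (h1 y)
    · exact scanSet_subset _ _ _ _ ((h1 y).1 hy)
  disjoint_semi_fix t y hy hy' := by
    obtain ⟨ht, hy⟩ := hy
    obtain ⟨_, hy'⟩ := hy'
    rcases round_cases B (stateAfter B (R.take t)) (hR _ (R.getElem_mem ht)) a with
      ⟨h1, -⟩ | ⟨b, -, -, h1, -⟩ | ⟨b, -, h1, -⟩
    · exact h1 y hy
    · exact h1 y hy'
    · exact h1 y hy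
  spread t y hy z hz :=
    (isLevel_stateAfter B hB a _ fun r hr => hR r (List.mem_of_mem_take hr)).2.le_add_one hy hz
  lowest_semi t y hy z hz hz' := by
    obtain ⟨ht, hy⟩ := hy
    rcases round_cases B (stateAfter B (R.take t)) (hR _ (R.getElem_mem ht)) a with
      ⟨h1, -⟩ | ⟨b, -, h1, -⟩ | ⟨b, -, h1, -⟩
    · exact absurd hy (h1 y)
    · exact (isLevel_stateAfter B hB a _ fun r hr =>
        hR r (List.mem_of_mem_take hr)).2.le_of_mem_scanSet ((h1 y).1 hy) hz
          fun h => hz' ⟨ht, (h1 z).2 h⟩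
    · exact absurd hy (h1 y)
  lowest_fix t y hy z hz hz' := by
    obtain ⟨ht, hy⟩ := hy
    rcases round_cases B (stateAfter B (R.take t)) (hR _ (R.getElem_mem ht)) a with
      ⟨-, h1, -⟩ | ⟨b, -, -, h1, -⟩ | ⟨b, -, -, h1, -⟩
    · exact absurd hy (h1 y)
    · exact absurd hy (h1 y)
    · exact (isLevel_stateAfter B hB a _ fun r hr =>
        hR r (List.mem_of_mem_take hr)).2.le_of_mem_scanSet ((h1 y).1 hy) hz
          fun h => hz' ⟨ht, (h1 z).2 h⟩

end PanTrace

/-! ## The panoramic online correlated selection -/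

section Selector

variable {A : Type*}

open Classical in
/-- The number of pairs of `l` in which point `y` of advertiser `a` occurs. -/
def pairCount (l : List (Combination A × Combination A)) (a : A) (y : ℝ) : ℕ :=
  l.countP fun p => (p.1.1 = a ∧ y ∈ p.1.2) ∨ (p.2.1 = a ∧ y ∈ p.2.2)

/-- The selector sees only the pairs of the randomized rounds; this suffices to compute the counts,
and hence the colours, online. -/
lemma pairCount_randomizedPairs (T : List (Step A)) (a : A) (y : ℝ) :
    pairCount (randomizedPairs T) a y = semiCount T a y := by
  induction T with
  | nil => rfl
  | cons s T ih =>
    simp only [pairCount, semiCount, randomizedPairs] at ih ⊢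
    cases s with
    | det c =>
      rw [List.filterMap_cons_none rfl, ih, List.countP_cons_of_neg]
      exact fun h => @of_decide_eq_true _ (_) h
    | rand c₁ c₂ =>
      rw [List.filterMap_cons_some (f := Step.pair) (b := (c₁, c₂)) rfl, List.countP_cons,
        List.countP_cons, ih]
      congr 1
      by_cases h : (c₁.1 = a ∧ y ∈ c₁.2) ∨ (c₂.1 = a ∧ y ∈ c₂.2)
      · exact (if_pos (@decide_eq_true _ (_) h)).trans (if_pos (@decide_eq_true _ (_) h)).symm
      · exact (if_neg fun h' => h (@of_decide_eq_true _ (_) h')).trans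
          (if_neg fun h' => h (@of_decide_eq_true _ (_) h')).symm

/-- The vertex of a combination, given the pairs seen before. -/
def comboVertex {n : ℕ} (e : A ≃ Fin n) (K : ℕ) [NeZero K]
    (l : List (Combination A × Combination A)) (c : Combination A) : Fin n × Fin K :=
  (e c.1, Fin.ofNat K (setColor (pairCount l c.1) c.2))

/-- The selector that orients every edge by the random orientation. -/
def orientSelector {n : ℕ} (e : A ≃ Fin n) (K : ℕ) [NeZero K] : PairSelector A where
  Seed := OrientSeed (Fin n) K
  measurableSpaceSeed := ⊤
  law := @PMF.toMeasure _ ⊤ (PMF.uniformOfFintype (OrientSeed (Fin n) K))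
  isProbabilityMeasure_law := @PMF.toMeasure.isProbabilityMeasure _ ⊤ _
  act ω l := match l.getLast? with
    | none => true
    | some p => orient ω (comboVertex e K l.dropLast p.1) (comboVertex e K l.dropLast p.2)
  measurableSet_act _ _ := trivial

lemma orientSelector_act {n : ℕ} (e : A ≃ Fin n) (K : ℕ) [NeZero K]
    (ω : OrientSeed (Fin n) K) (l : List (Combination A × Combination A))
    (p : Combination A × Combination A) :
    (orientSelector e K).act ω (l ++ [p]) =
      orient ω (comboVertex e K l p.1) (comboVertex e K l p.2) := by
  simp [orientSelector]

open Classical in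
lemma orientSelector_law_real {n : ℕ} (e : A ≃ Fin n) (K : ℕ) [NeZero K]
    (s : Set (OrientSeed (Fin n) K)) :
    Measure.real (α := (orientSelector e K).Seed) (orientSelector e K).law s =
      𝔼 ω : OrientSeed (Fin n) K, if ω ∈ s then (1 : ℝ) else 0 := by
  let _ : MeasurableSpace (OrientSeed (Fin n) K) := ⊤
  have h := PMF.toMeasure_uniformOfFintype_apply (α := OrientSeed (Fin n) K) (s := s) trivial
  change ((PMF.uniformOfFintype (OrientSeed (Fin n) K)).toMeasure s).toReal = _
  rw [h, Fintype.expect_eq_sum_div_card, ENNReal.toReal_div, ENNReal.toReal_natCast,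
    ENNReal.toReal_natCast, Finset.sum_boole]
  congr 2
  simp [Fintype.card_subtype]

lemma outcome_eq_fst (P : PairSelector A) (T : List (Step A)) (ω : P.Seed) {t : ℕ}
    (ht : t < T.length) {c₁ c₂ : Combination A} (h : T[t] = .rand c₁ c₂)
    (hact : P.act ω (randomizedPairs (T.take t) ++ [(c₁, c₂)]) = true) :
    outcome P T ω ⟨t, ht⟩ = c₁ := by
  have h2 : randomizedPairs (T.take (t + 1)) = randomizedPairs (T.take t) ++ [(c₁, c₂)] := by
    rw [take_succ_eq T ht, h]; simp [randomizedPairs, Step.pair]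
  simp only [outcome, Fin.getElem_fin, h, h2, hact, if_true]

lemma outcome_eq_snd (P : PairSelector A) (T : List (Step A)) (ω : P.Seed) {t : ℕ}
    (ht : t < T.length) {c₁ c₂ : Combination A} (h : T[t] = .rand c₁ c₂)
    (hact : P.act ω (randomizedPairs (T.take t) ++ [(c₁, c₂)]) = false) :
    outcome P T ω ⟨t, ht⟩ = c₂ := by
  have h2 : randomizedPairs (T.take (t + 1)) = randomizedPairs (T.take t) ++ [(c₁, c₂)] := by
    rw [take_succ_eq T ht, h]; simp [randomizedPairs, Step.pair]
  simp only [outcome, Fin.getElem_fin, h, h2, hact, Bool.false_eq_true, if_false]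

lemma outcome_eq_of_det (P : PairSelector A) (T : List (Step A)) (ω : P.Seed) {t : ℕ}
    (ht : t < T.length) {c : Combination A} (h : T[t] = .det c) :
    outcome P T ω ⟨t, ht⟩ = c := by
  simp only [outcome, Fin.getElem_fin, h]

/-! ### The guarantee of the orientation selector -/

variable [DecidableEq A] (B : A → ℝ)

/-- The edge that belongs to a semi-assignment. -/
lemma exists_edgeAt (hB : ∀ a, 0 < B a) (R : List (Round A)) (hR : ∀ r ∈ R, r.Valid B) (a : A)
    {n : ℕ} (e : A ≃ Fin n) (K : ℕ) [NeZero K] {t : ℕ} (ht : t < (panoramicSteps B R).length)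
    {y : ℝ} (hy : y ∈ (panTrace B hB R hR a).semi t) :
    ∃ E : EdgeAt (Fin n) K, E.other.1 ≠ e a ∧
      E.col = Fin.ofNat K (setColor ((panTrace B hB R hR a).cnt t) ((panTrace B hB R hR a).semi t)) ∧
      ∀ ω : OrientSeed (Fin n) K, E.selected (e a) ω = true →
        (outcome (orientSelector e K) (panoramicSteps B R) ω ⟨t, ht⟩).1 = a ∧
        y ∈ (outcome (orientSelector e K) (panoramicSteps B R) ω ⟨t, ht⟩).2 := by
  obtain ⟨ht', hy'⟩ := hy
  have hstep := getElem_panoramicSteps B R ht'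
  have hval := hR _ (R.getElem_mem ht')
  set τ := panTrace B hB R hR a with hτ
  have hcnt : pairCount (randomizedPairs ((panoramicSteps B R).take t)) a = τ.cnt t := by
    funext z
    rw [pairCount_randomizedPairs, take_panoramicSteps]; rfl
  have hsemi : τ.semi t = {z | ((stateAfter B (R.take t)).step B R[t]).SemiAssigns a z} := by
    ext z
    exact ⟨fun h => h.2, fun h => ⟨ht', h⟩⟩
  cases hr : R[t] with
  | det a' b => rw [hr] at hy'; exact absurd hy' (by simp [PanState.step, Step.SemiAssigns])
  | rand a₁ b₁ a₂ b₂ =>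
    rw [hr] at hy' hstep hval hsemi
    simp only [PanState.step] at hstep
    simp only [PanState.step, Step.SemiAssigns] at hy' hsemi
    have hne := hval.1
    rcases hy' with ⟨rfl, hy'⟩ | ⟨rfl, hy'⟩
    · have hsemi' : τ.semi t = PanState.nextSet B (stateAfter B (R.take t)) a₁ b₁ := by
        rw [hsemi]; ext z; simp [hne.symm]
      refine ⟨⟨_, comboVertex e K (randomizedPairs ((panoramicSteps B R).take t))
        (a₂, (stateAfter B (R.take t)).nextSet B a₂ b₂), true⟩, ?_, rfl, fun ω h => ?_⟩
      · simpa [comboVertex] using hne.symm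
      · rw [EdgeAt.selected, if_pos rfl, ← hcnt, hsemi'] at h
        rw [outcome_eq_fst _ _ _ ht hstep ((orientSelector_act ..).trans h)]
        exact ⟨rfl, hy'⟩
    · have hsemi' : τ.semi t = PanState.nextSet B (stateAfter B (R.take t)) a₂ b₂ := by
        rw [hsemi]; ext z; simp [hne]
      refine ⟨⟨_, comboVertex e K (randomizedPairs ((panoramicSteps B R).take t))
        (a₁, (stateAfter B (R.take t)).nextSet B a₁ b₁), false⟩, ?_, rfl, fun ω h => ?_⟩
      · simpa [comboVertex] using hne
      · rw [EdgeAt.selected, if_neg Bool.false_ne_true, Bool.not_eq_true', ← hcnt, hsemi'] at h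
        rw [outcome_eq_snd _ _ _ ht hstep ((orientSelector_act ..).trans h)]
        exact ⟨rfl, hy'⟩

/-- A point that is assigned in a deterministic round is assigned with probability one. -/
lemma assignProb_eq_one (P : PairSelector A) (T : List (Step A)) {a : A} {y : ℝ}
    (h : ∃ s ∈ T, s.Assigns a y) : assignProb P T a y = 1 := by
  obtain ⟨s, hs, hsa⟩ := h
  obtain ⟨t, ht, rfl⟩ := List.getElem_of_mem hs
  have : {ω : P.Seed | ∃ t : Fin T.length, (outcome P T ω t).1 = a ∧ y ∈ (outcome P T ω t).2} =
      univ := by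
    refine eq_univ_of_forall fun ω => ⟨⟨t, ht⟩, ?_⟩
    cases hc : T[t] with
    | det c =>
      rw [hc] at hsa
      rw [outcome_eq_of_det P T ω ht hc]
      exact hsa
    | rand c₁ c₂ => rw [hc] at hsa; exact absurd hsa (by simp [Step.Assigns])
  rw [assignProb, this, probReal_univ]

/-- With kmax = m + 1 there are K = 2 kmax - 1 = 2m + 1 colours. A point that is never assigned
loses all of its k edges, so `expect_never_selected_le` applies to the edges of its rounds. -/
lemma isPanOCS_orientSelector (hB : ∀ a, 0 < B a) {n : ℕ} (e : A ≃ Fin n) (m : ℕ) :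
    IsPanOCS B (m + 1) (0.01245 / ((m + 1 : ℕ) : ℝ)) (orientSelector e (2 * m + 1)) := by
  have hγ0 : (0 : ℝ) ≤ 0.01245 / ((m + 1 : ℕ) : ℝ) := by positivity
  have hγ1 : (0.01245 : ℝ) / ((m + 1 : ℕ) : ℝ) ≤ 1 := by
    rw [div_le_one (by positivity)]; push_cast; linarith [(Nat.cast_nonneg m : (0 : ℝ) ≤ m)]
  refine ⟨⟨hγ0, hγ1⟩, fun R hR hcap a y hy => ?_⟩
  set γ : ℝ := 0.01245 / ((m + 1 : ℕ) : ℝ) with hγ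
  set K := 2 * m + 1 with hK
  set T := panoramicSteps B R with hT
  by_cases hdet : ∃ s ∈ T, s.Assigns a y
  · rw [assignProb_eq_one _ _ hdet, kValue, if_pos hdet]; simp [panocsBound]
  rw [kValue, if_neg hdet, panocsBound, if_neg (ENat.natCast_ne_top _), ENat.toNat_natCast]
  set τ := panTrace B hB R hR a with hτ
  set k := semiCount T a y with hk
  have hkn : k = τ.cnt R.length y := by
    change _ = semiCount (panoramicSteps B (R.take R.length)) a y
    rw [List.take_length]
  rcases Nat.eq_zero_or_pos k with hk0 | hkpos
  · rw [hk0]; simp [assignProb]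
  have hlen : T.length = R.length := length_panoramicSteps B R
  have hcap' : ∀ t ≤ R.length, ∀ z ∈ Ico 0 (B a), τ.cnt t z ≤ m + 1 := by
    intro t ht z hz
    refine (τ.cnt_mono z ht).trans ?_
    change semiCount (panoramicSteps B (R.take R.length)) a z ≤ _
    rw [List.take_length]; exact hcap a z hz
  -- `t l` will be the round of the semi-assignment of `y` at count `l`; from `k` on the choices are
  -- arbitrary.
  have hex : ∀ l : ℕ, ∃ t, l < k → t < T.length ∧ y ∈ τ.semi t ∧ τ.cnt t y = l := by
    intro l
    by_cases hl : l < k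
    · obtain ⟨t, h1, h2⟩ := τ.exists_semi_of_lt_cnt (hkn ▸ hl)
      exact ⟨t, fun _ => ⟨by omega, h2⟩⟩
    · exact ⟨0, fun h => absurd h hl⟩
  choose t ht using hex
  have hex2 : ∀ l : ℕ, ∃ E : EdgeAt (Fin n) K, ∀ hl : l < k, E.other.1 ≠ e a ∧
      E.col = Fin.ofNat K (setColor (τ.cnt (t l)) (τ.semi (t l))) ∧
      ∀ ω : OrientSeed (Fin n) K, E.selected (e a) ω = true →
        (outcome (orientSelector e K) T ω ⟨t l, (ht l hl).1⟩).1 = a ∧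
        y ∈ (outcome (orientSelector e K) T ω ⟨t l, (ht l hl).1⟩).2 := by
    intro l
    by_cases hl : l < k
    · obtain ⟨E, hE⟩ := exists_edgeAt B hB R hR a e K (ht l hl).1 (ht l hl).2.1
      exact ⟨E, fun _ => hE⟩
    · exact ⟨⟨0, (e a, 0), true⟩, fun h => absurd h hl⟩
  choose E hE using hex2
  have hcol : ∀ l < k, ((E l).col : ℕ) = setColor (τ.cnt (t l)) (τ.semi (t l)) := by
    intro l hl
    rw [(hE l hl).2.1]
    -- `Fin.ofNat` reduces modulo `K`, but colours stay below `K`, so nothing wraps.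
    refine Nat.mod_eq_of_lt ?_
    have := τ.setColor_lt_of_cnt_le (ht l hl).2.1 (k := m + 1)
      (hcap' _ (by have := (ht l hl).1; omega))
    omega
  have hmain := expect_never_selected_le (N := Fin n) (K := K) (e a) k hkpos
    (by have := hcap' R.length le_rfl y hy; omega) E (fun l hl => (hE l hl).1) (fun l hl => by
      rw [hcol l (by omega), hcol (l + 1) hl]
      obtain ⟨h1, h2, h3⟩ := ht l (by omega)
      obtain ⟨h1', h2', h3'⟩ := ht (l + 1) hl
      refine τ.setColor_lt ?_ h2 h2' (by omega)
      by_contra hcon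
      have := τ.cnt_mono y (not_lt.1 hcon)
      simp only at this
      omega)
  classical
  set G : Set (OrientSeed (Fin n) K) := {ω | ∃ s : Fin T.length,
    (outcome (orientSelector e K) T ω s).1 = a ∧ y ∈ (outcome (orientSelector e K) T ω s).2} with hG
  have hprob : assignProb (orientSelector e K) T a y =
      𝔼 ω : OrientSeed (Fin n) K, if ω ∈ G then (1 : ℝ) else 0 :=
    (orientSelector_law_real e K G).trans (Finset.expect_congr rfl fun ω _ => by congr)
  have hsum : (𝔼 ω : OrientSeed (Fin n) K, if ω ∈ G then (1 : ℝ) else 0) =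
      1 - 𝔼 ω : OrientSeed (Fin n) K, if ω ∉ G then (1 : ℝ) else 0 := by
    rw [eq_sub_iff_add_eq, ← Finset.expect_add_distrib,
      ← Fintype.expect_const (ι := OrientSeed (Fin n) K) (1 : ℝ)]
    refine Finset.expect_congr rfl fun ω _ => ?_
    by_cases h : ω ∈ G <;> simp [h]
  have hle : (𝔼 ω : OrientSeed (Fin n) K, if ω ∉ G then (1 : ℝ) else 0) ≤
      𝔼 ω : OrientSeed (Fin n) K,
        if ∀ l ∈ Finset.range k, (E l).selected (e a) ω = false then (1 : ℝ) else 0 := by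
    refine Finset.expect_le_expect fun ω _ => ?_
    by_cases h : ω ∈ G
    · rw [if_neg (not_not.2 h)]; split_ifs <;> norm_num
    · rw [if_pos h, if_pos]
      intro l hl
      by_contra hs
      exact h ⟨_, (hE l (Finset.mem_range.1 hl)).2.2 ω (by simpa using hs)⟩
  -- Bernoulli's inequality, together with 0.01245 / (m + 1) ≤ 1 / (36 (2m + 1)).
  have hfin : ((1 : ℝ) / 2) ^ k * (1 - (k - 1) / (36 * K)) ≤ (1 / 2) ^ k * (1 - γ) ^ (k - 1) := by
    refine mul_le_mul_of_nonneg_left ?_ (by positivity)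
    have h1 : 1 + ((k - 1 : ℕ) : ℝ) * (-γ) ≤ (1 + -γ) ^ (k - 1) :=
      one_add_mul_le_pow (by linarith) _
    have h2 : γ ≤ 1 / (36 * K) := by
      rw [hγ, hK, div_le_div_iff₀ (by positivity) (by positivity)]
      push_cast
      linarith [(Nat.cast_nonneg m : (0 : ℝ) ≤ m)]
    have h3 : ((k - 1 : ℕ) : ℝ) = k - 1 := by push_cast [hkpos]; ring
    have h4 : ((k - 1 : ℕ) : ℝ) * γ ≤ ((k - 1 : ℕ) : ℝ) * (1 / (36 * K)) :=
      mul_le_mul_of_nonneg_left h2 (Nat.cast_nonneg _)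
    rw [mul_one_div, h3] at h4
    rw [h3] at h1
    rw [sub_eq_add_neg 1 γ]
    linarith
  rw [hprob, hsum]
  linarith

end Selector

/-! ## The measure of the subset found by a scan -/

section Scan

variable {β : ℝ} {D : Set ℝ} {p : ℝ}

lemma measurable_circOffset (β p : ℝ) : Measurable (circOffset β p) := by
  unfold circOffset
  exact Measurable.ite measurableSet_Ici (by fun_prop) (by fun_prop)

lemma measurableSet_circArc (β p t : ℝ) : MeasurableSet (circArc β p t) :=
  measurableSet_Ico.inter (measurable_circOffset β p measurableSet_Iio)

lemma measurableSet_scanSet (hD : MeasurableSet D) (b : ℝ) : MeasurableSet (scanSet β D p b) :=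
  (measurableSet_circArc _ _ _).diff hD

lemma circArc_subset (β p t : ℝ) : circArc β p t ⊆ Ico 0 β := fun _ h => h.1

lemma circArc_zero (hp : p ∈ Ico 0 β) : circArc β p 0 = ∅ := by
  refine eq_empty_of_forall_notMem fun z ⟨hz, h⟩ => ?_
  unfold circOffset at h
  obtain ⟨h1, h2⟩ := hz
  obtain ⟨h3, h4⟩ := hp
  split_ifs at h <;> linarith

lemma circArc_full (hp : p ∈ Ico 0 β) : circArc β p β = Ico 0 β := by
  refine (circArc_subset _ _ _).antisymm fun z hz => ⟨hz, ?_⟩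
  unfold circOffset
  obtain ⟨h1, h2⟩ := hz
  obtain ⟨h3, h4⟩ := hp
  split_ifs <;> linarith

lemma volume_ne_top_of_subset_Ico {S : Set ℝ} (hS : S ⊆ Ico 0 β) : volume S ≠ ⊤ :=
  ((measure_mono hS).trans_lt (by simp)).ne

lemma circArc_mono {s t : ℝ} (h : s ≤ t) : circArc β p s ⊆ circArc β p t :=
  fun _ hz => ⟨hz.1, hz.2.trans_le h⟩

/-- The collected measure is 1-Lipschitz in the scanned length: the additional points lie in one
interval before the end of the circle and one after it, of total length at most t - s. -/
lemma volume_circArc_diff_le {s t : ℝ} (hst : s ≤ t) :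
    volume.real (circArc β p t \ D) ≤ volume.real (circArc β p s \ D) + (t - s) := by
  have hsub : circArc β p t \ D ⊆ (circArc β p s \ D) ∪
      (Ico (p + s) (min (p + t) β) ∪ Ico (max (p + s - β) 0) (p + t - β)) := by
    rintro z ⟨⟨hz, h⟩, hzD⟩
    by_cases hzs : circOffset β p z < s
    · exact Or.inl ⟨⟨hz, hzs⟩, hzD⟩
    · right
      unfold circOffset at h hzs
      obtain ⟨h1, h2⟩ := hz
      split_ifs at h hzs
      · exact Or.inl ⟨by linarith, lt_min (by linarith) h2⟩
      · exact Or.inr ⟨max_le (by linarith) h1, by linarith⟩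
  have hfin : volume ((circArc β p s \ D) ∪
      (Ico (p + s) (min (p + t) β) ∪ Ico (max (p + s - β) 0) (p + t - β))) ≠ ⊤ := by
    refine (measure_union_lt_top (lt_top_iff_ne_top.2 (volume_ne_top_of_subset_Ico
      (sdiff_subset.trans (circArc_subset _ _ _)))) (measure_union_lt_top ?_ ?_)).ne <;> simp
  have h1 := (measureReal_mono hsub hfin).trans (measureReal_union_le _ _)
  have h2 := measureReal_union_le (μ := volume) (Ico (p + s) (min (p + t) β))
    (Ico (max (p + s - β) 0) (p + t - β))
  rw [Real.volume_real_Ico, Real.volume_real_Ico] at h2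
  have h3 : max (min (p + t) β - (p + s)) 0 + max (p + t - β - max (p + s - β) 0) 0 ≤ t - s := by
    rcases le_total (p + t) β with h | h <;> rcases le_total (p + s) β with h' | h'
    · rw [min_eq_left h, max_eq_right (by linarith : p + s - β ≤ 0),
        max_eq_right (by linarith : p + t - β - 0 ≤ 0), max_eq_left (by linarith)]
      linarith
    · rw [min_eq_left h, max_eq_left (by linarith : 0 ≤ p + s - β),
        max_eq_left (by linarith : (0 : ℝ) ≤ p + t - β - (p + s - β)), max_eq_left (by linarith)]
      linarith
    · rw [min_eq_right h, max_eq_right (by linarith : p + s - β ≤ 0),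
        max_eq_left (by linarith : 0 ≤ p + t - β - 0), max_eq_left (by linarith)]
      linarith
    · rw [min_eq_right h, max_eq_left (by linarith : 0 ≤ p + s - β),
        max_eq_left (by linarith : (0 : ℝ) ≤ p + t - β - (p + s - β)), max_eq_right (by linarith)]
      linarith
  linarith

/-- The scan collects measure `b` if that much is available. -/
lemma volume_scanSet (hβ : 0 < β) (hp : p ∈ Ico 0 β) {b : ℝ} (hb : 0 ≤ b) :
    volume.real (scanSet β D p b) = min b (volume.real (Ico 0 β \ D)) := by
  set φ : ℝ → ℝ := fun t => volume.real (circArc β p t \ D) with hφ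
  set L := {t | t ∈ Icc 0 β ∧ φ t ≤ b} with hL
  have h0 : (0 : ℝ) ∈ L := ⟨⟨le_rfl, hβ.le⟩, by simp [hφ, circArc_zero hp, hb]⟩
  have hbdd : BddAbove L := ⟨β, fun t ht => ht.1.2⟩
  have hs : scanLength β D p b = sSup L := rfl
  set s := sSup L with hs'
  have hs0 : 0 ≤ s := le_csSup hbdd h0
  have hsβ : s ≤ β := csSup_le ⟨0, h0⟩ fun t ht => ht.1.2
  -- By the Lipschitz bound, the supremum of the admissible lengths is admissible.
  have hle : φ s ≤ b := by
    refine le_of_forall_pos_le_add fun ε hε => ?_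
    obtain ⟨t, ht, hts⟩ := exists_lt_of_lt_csSup ⟨0, h0⟩ (show s - ε < s by linarith)
    have h1 := volume_circArc_diff_le (β := β) (p := p) (D := D) (le_csSup hbdd ht)
    have h2 := ht.2
    simp only [hφ] at h2 ⊢
    linarith
  have hfull : φ β = volume.real (Ico 0 β \ D) := by simp only [hφ, circArc_full hp]
  change volume.real (circArc β p (scanLength β D p b) \ D) = _
  rw [hs]
  change φ s = _
  rcases hsβ.eq_or_lt with h | h
  · rw [h] at hle ⊢; rw [← hfull, min_eq_right hle]
  · have heq : φ s = b := by
      by_contra hne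
      have hlt : φ s < b := lt_of_le_of_ne hle hne
      -- If less than `b` were collected before a full turn, the scan could go on for the missing
      -- amount, again by the Lipschitz bound.
      set t := min β (s + (b - φ s)) with ht
      have hst : s < t := lt_min h (by linarith)
      have htL : t ∈ L := by
        refine ⟨⟨by linarith, min_le_left _ _⟩, ?_⟩
        have h1 := volume_circArc_diff_le (β := β) (p := p) (D := D) hst.le
        have h2 : t ≤ s + (b - φ s) := min_le_right _ _
        simp only [hφ] at h2 ⊢
        linarith
      exact absurd (le_csSup hbdd htL) (not_le.2 hst)
    rw [heq, min_eq_left]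
    rw [← heq, ← hfull]
    exact measureReal_mono (sdiff_le_sdiff_right (circArc_mono hsβ))
      (volume_ne_top_of_subset_Ico (sdiff_subset.trans (circArc_subset _ _ _)))

end Scan

/-! ## Weights -/

/-- The part of the gain at a point that goes to the impression, when the point is semi-assigned
after `k` earlier semi-assignments. -/
def semiWeight : ℕ → ℝ
  -- Up to rounding, these values and those of `ownWeight` through count 10 come from alternately
  -- making `sum_semiWeight_add_ownWeight_le` and `le_ownWeight_add_semi` tight, starting with
  -- `ownWeight 0 = 0`. At count 11 the own weight exceeds 0.50005, so the impression needs nothing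
  -- any more.
  | 0 => 0.250025
  | 1 => 0.125038
  | 2 => 0.062471
  | 3 => 0.031206
  | 4 => 0.015581
  | 5 => 0.007768
  | 6 => 0.003856
  | 7 => 0.001888
  | 8 => 0.000886
  | 9 => 0.000356
  | 10 => 0.000048
  | _ => 0

/-- The part that stays with the advertiser at a point with `k` semi-assignments. -/
def ownWeight : ℕ → ℝ
  | 0 => 0.000000
  | 1 => 0.249975
  | 2 => 0.375109
  | 3 => 0.437638
  | 4 => 0.468889
  | 5 => 0.484515
  | 6 => 0.492339
  | 7 => 0.496274
  | 8 => 0.498279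
  | 9 => 0.499338
  | 10 => 0.499954
  | _ => 0.500392

lemma semiWeight_of_ge {k : ℕ} (hk : 11 ≤ k) : semiWeight k = 0 := by
  obtain ⟨k, rfl⟩ := Nat.exists_eq_add_of_le' hk
  rfl

lemma ownWeight_of_ge {k : ℕ} (hk : 11 ≤ k) : ownWeight k = 0.500392 := by
  obtain ⟨k, rfl⟩ := Nat.exists_eq_add_of_le' hk
  rfl

lemma semiWeight_nonneg (k : ℕ) : 0 ≤ semiWeight k := by
  rcases lt_or_ge k 11 with h | h
  · interval_cases k <;> norm_num [semiWeight]
  · rw [semiWeight_of_ge h]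

lemma semiWeight_antitone : Antitone semiWeight := by
  refine antitone_nat_of_succ_le fun k => ?_
  rcases lt_or_ge k 11 with h | h
  · interval_cases k <;> norm_num [semiWeight]
  · rw [semiWeight_of_ge h, semiWeight_of_ge (by omega)]

lemma ownWeight_monotone : Monotone ownWeight := by
  refine monotone_nat_of_le_succ fun k => ?_
  rcases lt_or_ge k 11 with h | h
  · interval_cases k <;> norm_num [ownWeight]
  · rw [ownWeight_of_ge h, ownWeight_of_ge (by omega)]

lemma ownWeight_nonneg (k : ℕ) : 0 ≤ ownWeight k :=
  le_trans (by norm_num [ownWeight]) (ownWeight_monotone (Nat.zero_le k))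

lemma ownWeight_le (k : ℕ) : ownWeight k ≤ 0.500392 := by
  rw [← ownWeight_of_ge (le_max_right k 11)]
  exact ownWeight_monotone (le_max_left _ _)

lemma semiWeight_le (k : ℕ) : semiWeight k ≤ 1 :=
  (semiWeight_antitone (Nat.zero_le k)).trans (by norm_num [semiWeight])

lemma le_ownWeight_add_semi (k : ℕ) : 0.50005 ≤ ownWeight k + 2 * semiWeight k := by
  rcases lt_or_ge k 11 with h | h
  · interval_cases k <;> norm_num [ownWeight, semiWeight]
  · rw [ownWeight_of_ge h, semiWeight_of_ge h]; norm_num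

lemma le_ownWeight_succ_add_semi (k : ℕ) :
    0.50005 ≤ ownWeight (k + 1) + 5 / 4 * semiWeight k := by
  rcases lt_or_ge k 11 with h | h
  · interval_cases k <;> norm_num [ownWeight, semiWeight]
  · rw [ownWeight_of_ge (by omega), semiWeight_of_ge h]; norm_num

lemma sum_semiWeight_of_ge {k : ℕ} (hk : 11 ≤ k) :
    ∑ l ∈ Finset.range k, semiWeight l = ∑ l ∈ Finset.range 11, semiWeight l := by
  symm
  refine Finset.sum_subset (Finset.range_mono hk) fun l _ hl => semiWeight_of_ge ?_
  simpa using hl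

/-- A deterministic assignment has gain at most one. -/
lemma sum_semiWeight_add_le (k : ℕ) :
    ∑ l ∈ Finset.range k, semiWeight l + 5 / 4 * semiWeight k + 0.500392 ≤ 1 := by
  rcases lt_or_ge k 11 with h | h
  · interval_cases k <;> norm_num [Finset.sum_range_succ, semiWeight]
  · rw [sum_semiWeight_of_ge h, semiWeight_of_ge h]
    norm_num [Finset.sum_range_succ, semiWeight]

/-- The total gain from semi-assignments is at most the probability that is guaranteed. -/
lemma sum_semiWeight_add_ownWeight_le (k : ℕ) :
    ∑ l ∈ Finset.range k, semiWeight l + ownWeight k ≤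
      1 - (1 / 2) ^ k * (1 - 0.01245 / 18) ^ (k - 1) := by
  rcases lt_or_ge k 11 with h | h
  · interval_cases k <;> norm_num [Finset.sum_range_succ, semiWeight, ownWeight]
  · rw [sum_semiWeight_of_ge h, ownWeight_of_ge h]
    have h1 : ((1 : ℝ) / 2) ^ k * (1 - 0.01245 / 18) ^ (k - 1) ≤
        -- From count 11 on the left side is constant while the guaranteed probability only grows.
        (1 / 2) ^ 11 * (1 - 0.01245 / 18) ^ (11 - 1) := by
      refine mul_le_mul (pow_le_pow_of_le_one (by norm_num) (by norm_num) h)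
        (pow_le_pow_of_le_one (by norm_num) (by norm_num) (by omega)) ?_ (by positivity)
      exact pow_nonneg (by norm_num) _
    refine le_trans ?_ (sub_le_sub_left h1 1)
    norm_num [Finset.sum_range_succ, semiWeight]

/-! ## Approximate dual feasibility -/

lemma integrableOn_comp_nat {c : ℝ → ℕ} (hc : Measurable c) {F : ℕ → ℝ} (hF0 : ∀ k, 0 ≤ F k)
    (hF1 : ∀ k, F k ≤ 1) {S : Set ℝ} (hS : volume S ≠ ⊤) :
    IntegrableOn (fun y => F (c y)) S := by
  refine IntegrableOn.of_bound hS.lt_top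
    (Measurable.of_discrete.comp hc).aestronglyMeasurable 1 (ae_of_all _ fun y => ?_)
  rw [Real.norm_of_nonneg (hF0 _)]
  exact hF1 _

lemma mul_measureReal_le_setIntegral {S : Set ℝ} (hS : MeasurableSet S) (hS' : volume S ≠ ⊤)
    {f : ℝ → ℝ} (hf : IntegrableOn f S) {C : ℝ} (h : ∀ y ∈ S, C ≤ f y) :
    C * volume.real S ≤ ∫ y in S, f y := by
  have h1 := setIntegral_mono_on (integrableOn_const hS' (C := C)) hf hS h
  rwa [setIntegral_const, smul_eq_mul, mul_comm] at h1

lemma setIntegral_le_mul_measureReal {S : Set ℝ} (hS : MeasurableSet S) (hS' : volume S ≠ ⊤)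
    {f : ℝ → ℝ} (hf : IntegrableOn f S) {C : ℝ} (h : ∀ y ∈ S, f y ≤ C) :
    ∫ y in S, f y ≤ C * volume.real S := by
  have h1 := setIntegral_mono_on hf (integrableOn_const hS' (C := C)) hS h
  rwa [setIntegral_const, smul_eq_mul, mul_comm] at h1

/-- A set of at least `θ` times the measure of `W` on which `f` is at least as large as `h`
elsewhere on `W` collects at least `θ` times as much. -/
lemma mul_setIntegral_le_of_greedy {S W V : Set ℝ} (hS : MeasurableSet S) (hW : MeasurableSet W)
    (hSfin : volume S ≠ ⊤) (hWfin : volume W ≠ ⊤) {f g : ℝ → ℝ}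
    (hf : Measurable f) (hf0 : ∀ y, 0 ≤ f y) (hf1 : ∀ y, f y ≤ 2)
    (hg : Measurable g) (hg0 : ∀ y, 0 ≤ g y) (hg1 : ∀ y, g y ≤ 2)
    (hgV : ∀ y ∈ W, y ∉ V → g y = 0) (hgf : ∀ y ∈ V, g y ≤ f y) {θ : ℝ} (hθ0 : 0 ≤ θ) (hθ1 : θ ≤ 1)
    (hcase : volume (V \ S) = 0 ∨
      (θ * volume.real W ≤ volume.real S ∧ ∃ C, 0 ≤ C ∧ (∀ y ∈ S, C ≤ f y) ∧ ∀ y ∈ V \ S, g y ≤ C)) :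
    θ * ∫ y in W, g y ≤ ∫ y in S, f y := by
  have hint : ∀ {h : ℝ → ℝ} {X : Set ℝ}, Measurable h → (∀ y, 0 ≤ h y) → (∀ y, h y ≤ 2) →
      volume X ≠ ⊤ → IntegrableOn h X := fun hm h0 h1 hX =>
    IntegrableOn.of_bound hX.lt_top hm.aestronglyMeasurable 2
      (ae_of_all _ fun y => by rw [Real.norm_of_nonneg (h0 y)]; exact h1 y)
  have hsub : ∀ {X Y : Set ℝ}, X ⊆ Y → volume Y ≠ ⊤ → volume X ≠ ⊤ := fun h hY =>
    ((measure_mono h).trans_lt hY.lt_top).ne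
  have hWS := hsub (inter_subset_left : W ∩ S ⊆ W) hWfin
  have hWdS := hsub (sdiff_subset : W \ S ⊆ W) hWfin
  have hSdW := hsub (sdiff_subset : S \ W ⊆ S) hSfin
  have e1 : ∫ y in W, g y = (∫ y in W ∩ S, g y) + ∫ y in W \ S, g y :=
    (integral_inter_add_sdiff hS (hint hg hg0 hg1 hWfin)).symm
  have e2 : ∫ y in S, f y = (∫ y in S ∩ W, f y) + ∫ y in S \ W, f y :=
    (integral_inter_add_sdiff hW (hint hf hf0 hf1 hSfin)).symm
  rw [inter_comm S W] at e2
  have h1 : ∫ y in W ∩ S, g y ≤ ∫ y in W ∩ S, f y := by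
    refine setIntegral_mono_on (hint hg hg0 hg1 hWS) (hint hf hf0 hf1 hWS) (hW.inter hS)
      fun y hy => ?_
    by_cases hyV : y ∈ V
    · exact hgf y hyV
    · rw [hgV y hy.1 hyV]; exact hf0 y
  have h0 : 0 ≤ ∫ y in W ∩ S, f y := integral_nonneg hf0
  have h0' : 0 ≤ ∫ y in S \ W, f y := integral_nonneg hf0
  rw [e1, e2]
  rcases hcase with hnull | ⟨hm, C, hC0, hCf, hCg⟩
  · have h2 : ∫ y in W \ S, g y = 0 := by
      refine setIntegral_eq_zero_of_ae_eq_zero ?_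
      have : ∀ᵐ y, y ∉ V \ S := measure_eq_zero_iff_ae_notMem.1 hnull
      filter_upwards [this] with y hy hyW
      exact hgV y hyW.1 fun h => hy ⟨h, hyW.2⟩
    rw [h2]
    nlinarith
  · have h2 : ∫ y in W \ S, g y ≤ C * volume.real (W \ S) := by
      refine setIntegral_le_mul_measureReal (hW.diff hS) hWdS (hint hg hg0 hg1 hWdS) fun y hy => ?_
      by_cases hyV : y ∈ V
      · exact hCg y ⟨hyV, hy.2⟩
      · rw [hgV y hy.1 hyV]; exact hC0
    have h3 : C * volume.real (W ∩ S) ≤ ∫ y in W ∩ S, f y :=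
      mul_measureReal_le_setIntegral (hW.inter hS) hWS (hint hf hf0 hf1 hWS) fun y hy => hCf y hy.2
    have h4 : C * volume.real (S \ W) ≤ ∫ y in S \ W, f y :=
      mul_measureReal_le_setIntegral (hS.diff hW) hSdW (hint hf hf0 hf1 hSdW) fun y hy => hCf y hy.1
    have m1 : volume.real (W ∩ S) + volume.real (W \ S) = volume.real W :=
      measureReal_inter_add_sdiff hS hWfin
    have m2 : volume.real (S ∩ W) + volume.real (S \ W) = volume.real S :=
      measureReal_inter_add_sdiff hW hSfin
    rw [inter_comm S W] at m2
    -- This rearranges to θ |W \ S| ≤ |S \ W| + (1 - θ) |W ∩ S|, up to the factor `C`. So what is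
    -- due on `W \ S` is paid by `f` on `S \ W` and by the unused share 1 - θ of `f` on `W ∩ S`.
    have h5 : C * (θ * volume.real W) ≤ C * volume.real S := mul_le_mul_of_nonneg_left hm hC0
    rw [← m1, ← m2] at h5
    have h6 : θ * (∫ y in W \ S, g y) ≤ θ * (C * volume.real (W \ S)) :=
      mul_le_mul_of_nonneg_left h2 hθ0
    have h7 : θ * (∫ y in W ∩ S, g y) ≤ θ * ∫ y in W ∩ S, f y := mul_le_mul_of_nonneg_left h1 hθ0
    have h8 : (1 - θ) * (C * volume.real (W ∩ S)) ≤ (1 - θ) * ∫ y in W ∩ S, f y :=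
      mul_le_mul_of_nonneg_left h3 (by linarith)
    nlinarith

namespace Trace

variable {β : ℝ} (τ : Trace β)

open Classical in
/-- The part of the gain at a point that stays with the advertiser. -/
def own (n : ℕ) (y : ℝ) : ℝ := if y ∈ τ.det n then 0.500392 else ownWeight (τ.cnt n y)

lemma own_nonneg (n : ℕ) (y : ℝ) : 0 ≤ τ.own n y := by
  unfold own; split_ifs
  · norm_num
  · exact ownWeight_nonneg _

lemma own_le (n : ℕ) (y : ℝ) : τ.own n y ≤ 1 := by
  unfold own; split_ifs
  · norm_num
  · exact (ownWeight_le _).trans (by norm_num)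

lemma measurable_own (n : ℕ) (hc : Measurable (τ.cnt n)) (hd : MeasurableSet (τ.det n)) :
    Measurable (τ.own n) :=
  Measurable.ite hd measurable_const
    ((Measurable.of_discrete (f := ownWeight)).comp hc)

/-- Approximate dual feasibility for one advertiser. `off t` is the subset that is offered to the
impression of time `t`, and `val t` is the dual value of that impression. -/
theorem dual_feasible (n : ℕ) (hcm : ∀ t, Measurable (τ.cnt t))
    (hdm : ∀ t, MeasurableSet (τ.det t)) (off : ℕ → Set ℝ) (bid val : ℕ → ℝ)
    (T : Finset ℕ) (hT : ∀ t ∈ T, t < n)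
    (hom : ∀ t ∈ T, MeasurableSet (off t)) (hos : ∀ t ∈ T, off t ⊆ Ico 0 β \ τ.det t)
    (hol : ∀ t ∈ T, ∀ y ∈ off t, ∀ z ∈ Ico 0 β \ τ.det t, z ∉ off t → τ.cnt t y ≤ τ.cnt t z)
    (hov : ∀ t ∈ T, volume.real (off t) = min (bid t) (volume.real (Ico 0 β \ τ.det t)))
    (hval : ∀ t ∈ T, (τ.fix t = off t ∧ 0 ≤ val t) ∨
      (τ.semi t = off t ∧ 5 / 4 * ∫ y in off t, semiWeight (τ.cnt t y) ≤ val t) ∨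
      2 * ∫ y in off t, semiWeight (τ.cnt t y) ≤ val t) (hβ : 0 < β) :
    0.50005 * min (∑ t ∈ T, bid t) β ≤ (∫ y in Ico 0 β, τ.own n y) + ∑ t ∈ T, val t := by
  classical
  have hfin : ∀ {S : Set ℝ}, S ⊆ Ico 0 β → volume S ≠ ⊤ := volume_ne_top_of_subset_Ico
  have hownI : ∀ {S : Set ℝ}, S ⊆ Ico 0 β → IntegrableOn (τ.own n) S := fun hS =>
    IntegrableOn.of_bound (hfin hS).lt_top
      (τ.measurable_own n (hcm n) (hdm n)).aestronglyMeasurable 1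
      (ae_of_all _ fun y => by rw [Real.norm_of_nonneg (τ.own_nonneg n y)]; exact τ.own_le n y)
  have hr0 : ∀ t, 0 ≤ ∫ y in off t, semiWeight (τ.cnt t y) := fun t =>
    integral_nonneg fun y => semiWeight_nonneg _
  have hval0 : ∀ t ∈ T, 0 ≤ val t := by
    intro t ht
    have := hr0 t
    rcases hval t ht with h | h | h
    · exact h.2
    · linarith [h.2]
    · linarith
  have hvolI : volume.real (Ico 0 β) = β := by rw [Real.volume_real_Ico]; simp [hβ.le]
  set V := Ico 0 β \ τ.det n with hV
  have hVI : V ⊆ Ico 0 β := sdiff_subset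
  have hVm : MeasurableSet V := measurableSet_Ico.diff (hdm n)
  -- If almost every point was assigned deterministically, the own weights 0.500392 alone suffice.
  by_cases hVnull : volume V = 0
  · have h1 : (∫ y in Ico 0 β, τ.own n y) =
        (∫ y in Ico 0 β ∩ τ.det n, τ.own n y) + ∫ y in V, τ.own n y :=
      (integral_inter_add_sdiff (hdm n) (hownI subset_rfl)).symm
    have h2 : 0 ≤ ∫ y in V, τ.own n y := integral_nonneg (τ.own_nonneg n)
    have h3 : 0.50005 * volume.real (Ico 0 β ∩ τ.det n) ≤ ∫ y in Ico 0 β ∩ τ.det n, τ.own n y :=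
      mul_measureReal_le_setIntegral (measurableSet_Ico.inter (hdm n)) (hfin inter_subset_left)
        (hownI inter_subset_left) fun y hy => by rw [own, if_pos hy.2]; norm_num
    have h4 : volume.real (Ico 0 β ∩ τ.det n) + volume.real V = volume.real (Ico 0 β) :=
      measureReal_inter_add_sdiff (hdm n) (hfin subset_rfl)
    rw [measureReal_def volume V, hVnull, hvolI, ENNReal.toReal_zero, add_zero] at h4
    have h5 := Finset.sum_nonneg hval0
    have h6 := min_le_right (∑ t ∈ T, bid t) β
    rw [h4] at h3
    linarith
  -- Let `N` be the least final count of a surviving point. As scans take lowest counts first, no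
  -- point scanned earlier had a count above `N`.
  obtain ⟨z₀, hz₀V, hz₀⟩ : ∃ z₀ ∈ V, ∀ z ∈ V, τ.cnt n z₀ ≤ τ.cnt n z := by
    have hne : V.Nonempty := nonempty_of_measure_ne_zero hVnull
    obtain ⟨z₀, hz₀, hm⟩ := Nat.sInf_mem (hne.image (τ.cnt n))
    exact ⟨z₀, hz₀, fun z hz => by rw [hm]; exact Nat.sInf_le ⟨z, hz, rfl⟩⟩
  set N := τ.cnt n z₀ with hN
  have hsemiN : ∀ t < n, ∀ y ∈ τ.semi t, τ.cnt t y ≤ N := fun t ht y hy =>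
    τ.cnt_le_of_mem_semi ht hy hz₀V
  have hfixN : ∀ t < n, ∀ y ∈ τ.fix t, τ.cnt t y ≤ N := fun t ht y hy =>
    τ.cnt_le_of_mem_fix ht hy hz₀V
  -- the deficits
  set g : ℝ → ℝ := fun y => if y ∈ τ.det n then 0 else max 0 (0.50005 - ownWeight (τ.cnt n y)) with hg
  set M : ℝ := max 0 (0.50005 - ownWeight N) with hM
  have hM0 : 0 ≤ M := le_max_left _ _
  have hMle : M ≤ 0.50005 := max_le (by norm_num) (by linarith [ownWeight_nonneg N])
  have hgm : Measurable g := Measurable.ite (hdm n) measurable_const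
    ((Measurable.of_discrete (f := fun k => max 0 (0.50005 - ownWeight k))).comp (hcm n))
  have hg0 : ∀ y, 0 ≤ g y := fun y => by
    simp only [hg]; split_ifs
    · exact le_rfl
    · exact le_max_left _ _
  have hgG : ∀ y, g y ≤ 0.50005 := fun y => by
    simp only [hg]; split_ifs
    · norm_num
    · exact max_le (by norm_num) (by linarith [ownWeight_nonneg (τ.cnt n y)])
  have hgM : ∀ y ∈ V, g y ≤ M := fun y hy => by
    simp only [hg, if_neg hy.2, hM]
    exact max_le_max_left _ (sub_le_sub_left (ownWeight_monotone (hz₀ y hy)) _)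
  have hgown : ∀ y, 0.50005 - g y ≤ τ.own n y := fun y => by
    simp only [hg, own]; split_ifs
    · norm_num
    · linarith [le_max_right (0 : ℝ) (0.50005 - ownWeight (τ.cnt n y))]
  have hgdet : ∀ y ∈ Ico 0 β, y ∉ V → g y = 0 := fun y hy hyV => by
    have : y ∈ τ.det n := by by_contra h; exact hyV ⟨hy, h⟩
    simp only [hg, if_pos this]
  have hgsemi : ∀ t < n, ∀ y ∈ V, g y ≤ 2 * semiWeight (τ.cnt t y) := fun t ht y hy => by
    simp only [hg, if_neg hy.2]
    refine max_le (by linarith [semiWeight_nonneg (τ.cnt t y)]) ?_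
    have h1 := le_ownWeight_add_semi (τ.cnt n y)
    have h2 : semiWeight (τ.cnt n y) ≤ semiWeight (τ.cnt t y) :=
      semiWeight_antitone (τ.cnt_mono y ht.le)
    linarith
  -- the points that pay for themselves
  let O : ℕ → Set ℝ := fun t => if τ.fix t = off t then off t
    else if τ.semi t = off t then {y | y ∈ off t ∧ τ.cnt t y = N} else ∅
  have hOoff : ∀ t, O t ⊆ off t := fun t y hy => by
    simp only [O] at hy
    split_ifs at hy
    · exact hy
    · exact hy.1
    · exact absurd hy (notMem_empty y)
  have hOI : ∀ t ∈ T, O t ⊆ Ico 0 β := fun t ht => (hOoff t).trans ((hos t ht).trans sdiff_subset)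
  have hOm : ∀ t ∈ T, MeasurableSet (O t) := fun t ht => by
    simp only [O]
    split_ifs
    · exact hom t ht
    · exact (hom t ht).inter (hcm t (measurableSet_singleton N))
    · exact MeasurableSet.empty
  have hOcases : ∀ t, ∀ y ∈ O t, y ∈ τ.fix t ∨ (y ∈ τ.semi t ∧ τ.cnt t y = N) := fun t y hy => by
    simp only [O] at hy
    split_ifs at hy with h1 h2
    · exact Or.inl (h1 ▸ hy)
    · exact Or.inr ⟨h2 ▸ hy.1, hy.2⟩
    · exact absurd hy (notMem_empty y)
  -- A point semi-assigned at count `N` afterwards has count `N + 1`, too high for any later scan.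
  -- Such points are therefore charged to one impression only.
  have hlate : ∀ t < n, ∀ y ∈ τ.semi t, τ.cnt t y = N → ∀ j, t < j → j < n →
      y ∉ τ.semi j ∧ y ∉ τ.fix j := fun t ht y hy hyN j htj hj => by
    have h1 := τ.cnt_lt_of_mem_semi htj hy
    exact ⟨fun h => by have := hsemiN j hj y h; omega, fun h => by have := hfixN j hj y h; omega⟩
  have hOdisj' : ∀ t, ∀ j < n, t < j → Disjoint (O t) (O j) := fun t j hj htj => by
    refine Set.disjoint_left.2 fun y h1 h2 => ?_
    have hyj : y ∉ τ.det j := by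
      rcases hOcases j y h2 with h | h
      · exact (τ.fix_subset j h).2
      · exact (τ.semi_subset j h.1).2
    rcases hOcases t y h1 with h | h
    · refine hyj (τ.det_mono htj ?_)
      rw [Nat.succ_eq_add_one, τ.det_succ]
      exact Or.inr h
    · have := hlate t (by omega) y h.1 h.2 j htj hj
      rcases hOcases j y h2 with h | h
      · exact this.2 h
      · exact this.1 h.1
  have hOdisj : Set.PairwiseDisjoint (T : Set ℕ) O := fun t ht j hj hne => by
    rcases lt_or_gt_of_ne hne with h | h
    · exact hOdisj' t j (hT j hj) h
    · exact (hOdisj' j t (hT t ht) h).symm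
  set U := ⋃ t ∈ T, O t with hU
  have hUm : MeasurableSet U := Finset.measurableSet_biUnion T hOm
  have hUI : U ⊆ Ico 0 β := iUnion₂_subset hOI
  set W := Ico 0 β \ U with hW
  have hWI : W ⊆ Ico 0 β := sdiff_subset
  have hWm : MeasurableSet W := measurableSet_Ico.diff hUm
  set w := volume.real W with hw
  have hw0 : 0 ≤ w := measureReal_nonneg
  set Q := ∫ y in W, g y with hQ
  have hQ0 : 0 ≤ Q := integral_nonneg hg0
  have hgI : ∀ {S : Set ℝ}, S ⊆ Ico 0 β → IntegrableOn g S := fun hS =>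
    IntegrableOn.of_bound (hfin hS).lt_top hgm.aestronglyMeasurable 1
      (ae_of_all _ fun y => by
        rw [Real.norm_of_nonneg (hg0 y)]; exact (hgG y).trans (by norm_num))
  have hQw : Q ≤ 0.50005 * w :=
    setIntegral_le_mul_measureReal hWm (hfin hWI) (hgI hWI) fun y _ => hgG y
  have hvolU : volume.real U = ∑ t ∈ T, volume.real (O t) :=
    measureReal_biUnion_finset hOdisj hOm fun t ht => hfin (hOI t ht)
  have hUw : volume.real U + w = β := by
    rw [← hvolI, ← measureReal_inter_add_sdiff hUm (hfin subset_rfl), inter_eq_self_of_subset_right hUI]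
  have hOvol : ∀ t ∈ T, volume.real (O t) ≤ bid t := fun t ht =>
    (measureReal_mono (hOoff t) (hfin ((hos t ht).trans sdiff_subset))).trans
      ((hov t ht).le.trans (min_le_left _ _))
  -- the contribution of an impression
  have hitem : ∀ t ∈ T, 0.50005 * volume.real (O t) + min 1 ((bid t - volume.real (O t)) / w) * Q ≤
      val t + ∫ y in O t, τ.own n y := by
    intro t ht
    have htn := hT t ht
    have hoI : off t ⊆ Ico 0 β := (hos t ht).trans sdiff_subset
    have hVsub : V ⊆ Ico 0 β \ τ.det t := sdiff_le_sdiff_left (τ.det_mono htn.le)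
    have hθ0 : 0 ≤ min 1 ((bid t - volume.real (O t)) / w) :=
      le_min zero_le_one (div_nonneg (by linarith [hOvol t ht]) hw0)
    have hθ1 : min 1 ((bid t - volume.real (O t)) / w) ≤ 1 := min_le_left _ _
    have hθw : min 1 ((bid t - volume.real (O t)) / w) * w ≤ bid t - volume.real (O t) := by
      rcases hw0.eq_or_lt with h | h
      · rw [← h, mul_zero]; linarith [hOvol t ht]
      · rw [← le_div_iff₀ h]; exact min_le_right _ _
    -- Either the offer has the full size of the bid, or it exhausts the available points and hence
    -- almost all of `V`.
    have hcap : volume.real (off t) = bid t ∨ volume (V \ off t) = 0 := by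
      rcases min_choice (bid t) (volume.real (Ico 0 β \ τ.det t)) with h | h
      · left; rw [hov t ht, h]
      · right
        have h1 : volume.real ((Ico 0 β \ τ.det t) \ off t) = 0 := by
          rw [measureReal_sdiff (hos t ht) (hom t ht) (hfin sdiff_subset), hov t ht, h, sub_self]
        rw [measureReal_def, ENNReal.toReal_eq_zero_iff] at h1
        rcases h1 with h1 | h1
        · exact measure_mono_null (sdiff_le_sdiff_right hVsub) h1
        · exact absurd h1 (hfin (sdiff_subset.trans sdiff_subset))
    have hswm : Measurable fun y => semiWeight (τ.cnt t y) :=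
      (Measurable.of_discrete (f := semiWeight)).comp (hcm t)
    have hswI : ∀ {S : Set ℝ}, S ⊆ Ico 0 β → IntegrableOn (fun y => semiWeight (τ.cnt t y)) S :=
      fun hS => integrableOn_comp_nat (hcm t) semiWeight_nonneg semiWeight_le (hfin hS)
    by_cases hI : τ.fix t = off t
    · have hO : O t = off t := if_pos hI
      have hdet : off t ⊆ τ.det n := by
        rw [← hI]
        refine subset_trans ?_ (τ.det_mono (Nat.succ_le_of_lt htn))
        rw [Nat.succ_eq_add_one, τ.det_succ]
        exact subset_union_right
      -- A deterministic offer is disjoint from `V`; exhausting `V` would make it null.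
      have hbid : volume.real (off t) = bid t := hcap.resolve_right fun h => hVnull (by
        rwa [(Set.disjoint_left.2 fun y hy hy' => hy.2 (hdet hy')).sdiff_eq_left] at h)
      rw [hO, hbid, sub_self, zero_div, min_eq_right zero_le_one, zero_mul, add_zero, ← hbid]
      have h1 : 0.50005 * volume.real (off t) ≤ ∫ y in off t, τ.own n y :=
        mul_measureReal_le_setIntegral (hom t ht) (hfin hoI) (hownI hoI) fun y hy => by
          rw [own, if_pos (hdet hy)]; norm_num
      linarith [hval0 t ht]
    by_cases hII : τ.semi t = off t
    · have hO : O t = {y | y ∈ off t ∧ τ.cnt t y = N} := by simp only [O, if_neg hI, if_pos hII]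
      set E := off t \ O t with hE
      have hEm : MeasurableSet E := (hom t ht).diff (hOm t ht)
      have hEI : E ⊆ Ico 0 β := sdiff_subset.trans hoI
      have hval1 : 5 / 4 * ∫ y in off t, semiWeight (τ.cnt t y) ≤ val t := by
        have := hr0 t
        rcases hval t ht with h | h | h
        · exact absurd h.1 hI
        · exact h.2
        · linarith
      have hsplit : (∫ y in off t, semiWeight (τ.cnt t y)) =
          (∫ y in O t, semiWeight (τ.cnt t y)) + ∫ y in E, semiWeight (τ.cnt t y) := by
        rw [← integral_inter_add_sdiff (hOm t ht) (hswI hoI),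
          inter_eq_self_of_subset_right (hOoff t)]
      have h1 : semiWeight N * volume.real (O t) ≤ ∫ y in O t, semiWeight (τ.cnt t y) :=
        mul_measureReal_le_setIntegral (hOm t ht) (hfin (hOI t ht)) (hswI (hOI t ht))
          fun y hy => by rw [hO] at hy; rw [hy.2]
      -- Points of `E` have count below `N`, so 5/4 of their weight covers the largest deficit `M`.
      have h2 : 4 / 5 * M * volume.real E ≤ ∫ y in E, semiWeight (τ.cnt t y) := by
        refine mul_measureReal_le_setIntegral hEm (hfin hEI) (hswI hEI) fun y hy => ?_
        have hlt : τ.cnt t y < N := by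
          refine lt_of_le_of_ne (hsemiN t htn y (hII ▸ hy.1)) fun h => hy.2 ?_
          rw [hO]; exact ⟨hy.1, h⟩
        have h3 := le_ownWeight_succ_add_semi (τ.cnt t y)
        have h4 := ownWeight_monotone (Nat.succ_le_of_lt hlt)
        rw [Nat.succ_eq_add_one] at h4
        have : M ≤ 5 / 4 * semiWeight (τ.cnt t y) :=
          max_le (by linarith [semiWeight_nonneg (τ.cnt t y)]) (by linarith)
        linarith
      -- A point of `O t` finally has count at least `N + 1` and is never assigned
      -- deterministically. What its own weight lacks is at most the 5/4 `semiWeight N` that the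
      -- impression contributes there.
      have h3 : (0.50005 - 5 / 4 * semiWeight N) * volume.real (O t) ≤ ∫ y in O t, τ.own n y := by
        refine mul_measureReal_le_setIntegral (hOm t ht) (hfin (hOI t ht)) (hownI (hOI t ht))
          fun y hy => ?_
        rw [hO, ← hII] at hy
        have hnd : y ∉ τ.det n := fun h => by
          obtain ⟨j, hj, hyj⟩ := τ.exists_mem_fix_of_mem_det h
          rcases lt_trichotomy j t with hjt | rfl | hjt
          · refine (τ.semi_subset t hy.1).2 (τ.det_mono hjt ?_)
            rw [Nat.succ_eq_add_one, τ.det_succ]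
            exact Or.inr hyj
          · exact τ.disjoint_semi_fix j y hy.1 hyj
          · exact (hlate t htn y hy.1 hy.2 j hjt hj).2 hyj
        have h4 := τ.cnt_lt_of_mem_semi htn hy.1
        rw [hy.2] at h4
        have h5 := ownWeight_monotone h4
        have h6 := le_ownWeight_succ_add_semi N
        rw [own, if_neg hnd]
        linarith
      -- The comparison is restricted to `V ∩ W`, since the points of `off t` outside `E` lie in `U`
      -- and carry none of the deficit `Q`.
      have h4 : min 1 ((bid t - volume.real (O t)) / w) * Q ≤ ∫ y in E, M := by
        refine mul_setIntegral_le_of_greedy (V := V ∩ W) hEm hWm (hfin hEI) (hfin hWI)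
          measurable_const (fun _ => hM0) (fun _ => hMle.trans (by norm_num)) hgm hg0
          (fun y => (hgG y).trans (by norm_num))
          (fun y hy hyV => hgdet y (hWI hy) fun h => hyV ⟨h, hy⟩) (fun y hy => hgM y hy.1) hθ0 hθ1 ?_
        rcases hcap with hcap | hcap
        · right
          refine ⟨?_, M, hM0, fun _ _ => le_rfl, fun y hy => hgM y hy.1.1⟩
          rw [hE, measureReal_sdiff (hOoff t) (hOm t ht) (hfin hoI), hcap]
          exact hθw
        · left
          refine measure_mono_null (t := V \ off t) ?_ hcap
          rintro y ⟨⟨hyV, hyW⟩, hyE⟩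
          exact ⟨hyV, fun hyo => hyE ⟨hyo, fun hyO =>
            hyW.2 (mem_biUnion (x := t) (Finset.mem_coe.2 ht) hyO)⟩⟩
      rw [setIntegral_const, smul_eq_mul] at h4
      nlinarith
    · have hO : O t = ∅ := by simp only [O, if_neg hI, if_neg hII]
      have hval2 : 2 * ∫ y in off t, semiWeight (τ.cnt t y) ≤ val t := by
        rcases hval t ht with h | h | h
        · exact absurd h.1 hI
        · exact absurd h.1 hII
        · exact h
      have h4 : min 1 ((bid t - volume.real (O t)) / w) * Q ≤
          ∫ y in off t, 2 * semiWeight (τ.cnt t y) := by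
        refine mul_setIntegral_le_of_greedy (V := V) (hom t ht) hWm (hfin hoI) (hfin hWI)
          (hswm.const_mul 2) (fun y => by linarith [semiWeight_nonneg (τ.cnt t y)])
          (fun y => by linarith [semiWeight_le (τ.cnt t y)]) hgm hg0
          (fun y => (hgG y).trans (by norm_num)) (fun y hy hyV => hgdet y (hWI hy) hyV)
          (hgsemi t htn) hθ0 hθ1 ?_
        rcases (V \ off t).eq_empty_or_nonempty with hem | hne
        · left; rw [hem]; exact measure_empty
        rcases hcap with hcap | hcap
        · right
          -- Twice the weight at a point of least count missed by the offer separates the two sides: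
          -- offered points weigh at least as much, missed points of `V` at most.
          obtain ⟨z₁, hz₁, hm⟩ := Nat.sInf_mem (hne.image (τ.cnt t))
          refine ⟨by rw [hcap]; simpa [hO] using hθw, 2 * semiWeight (τ.cnt t z₁),
            by linarith [semiWeight_nonneg (τ.cnt t z₁)], fun y hy => ?_, fun y hy => ?_⟩
          · have := semiWeight_antitone (hol t ht y hy z₁ (hVsub hz₁.1) hz₁.2)
            linarith
          · refine (hgsemi t htn y hy.1).trans ?_
            have h5 : τ.cnt t z₁ ≤ τ.cnt t y := by rw [hm]; exact Nat.sInf_le ⟨y, hy, rfl⟩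
            have := semiWeight_antitone h5
            linarith
        · exact Or.inl hcap
      rw [integral_const_mul] at h4
      have h5 : volume.real (O t) = 0 := by rw [hO]; simp
      have h6 : ∫ y in O t, τ.own n y = 0 := by rw [hO]; simp
      rw [h5] at h4
      rw [h6, h5]
      linarith
  -- summation
  have hsum := Finset.sum_le_sum hitem
  rw [Finset.sum_add_distrib, Finset.sum_add_distrib, ← Finset.mul_sum, ← hvolU,
    ← Finset.sum_mul] at hsum
  have hownU : ∑ t ∈ T, ∫ y in O t, τ.own n y = ∫ y in U, τ.own n y :=
    (integral_biUnion_finset T hOm hOdisj fun t ht => hownI (hOI t ht)).symm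
  have hownsplit : (∫ y in Ico 0 β, τ.own n y) =
      (∫ y in U, τ.own n y) + ∫ y in W, τ.own n y := by
    rw [← integral_inter_add_sdiff hUm (hownI subset_rfl), inter_eq_self_of_subset_right hUI]
  have hownW : 0.50005 * w - Q ≤ ∫ y in W, τ.own n y := by
    have hc : IntegrableOn (fun _ : ℝ => (0.50005 : ℝ)) W := integrableOn_const (hfin hWI)
    have h1 : ∫ y in W, (0.50005 - g y) ≤ ∫ y in W, τ.own n y :=
      setIntegral_mono (hc.sub (hgI hWI)) (hownI hWI) hgown
    rw [integral_sub hc (hgI hWI), setIntegral_const, smul_eq_mul] at h1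
    linarith
  set S := ∑ t ∈ T, (bid t - volume.real (O t)) with hS
  have hS0 : 0 ≤ S := Finset.sum_nonneg fun t ht => by linarith [hOvol t ht]
  have hSeq : ∑ t ∈ T, bid t = volume.real U + S := by
    rw [hS, Finset.sum_sub_distrib, hvolU]; ring
  -- Truncation at 1 is subadditive on nonnegative terms: one term of size at least 1 suffices, and
  -- otherwise nothing is truncated.
  have hθ : min 1 (S / w) ≤ ∑ t ∈ T, min 1 ((bid t - volume.real (O t)) / w) := by
    rw [hS, Finset.sum_div]
    have hnn : ∀ t ∈ T, 0 ≤ (bid t - volume.real (O t)) / w := fun t ht =>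
      div_nonneg (by linarith [hOvol t ht]) hw0
    by_cases hbig : ∃ t ∈ T, 1 ≤ (bid t - volume.real (O t)) / w
    · obtain ⟨t, ht, hbig⟩ := hbig
      refine (min_le_left _ _).trans ((min_eq_left hbig).symm.le.trans ?_)
      exact Finset.single_le_sum (f := fun t => min 1 ((bid t - volume.real (O t)) / w))
        (fun i hi => le_min zero_le_one (hnn i hi)) ht
    · push Not at hbig
      refine (min_le_right _ _).trans (Finset.sum_le_sum fun t ht => ?_)
      rw [min_eq_right (hbig t ht).le]
  have hmin : min (∑ t ∈ T, bid t) β = volume.real U + min S w := by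
    rw [hSeq, ← hUw, min_add_add_left]
  have hSw : min S w ≤ w * min 1 (S / w) := by
    rcases hw0.eq_or_lt with h | h
    · rw [← h, zero_mul]; exact min_le_right _ _
    · rw [mul_min_of_nonneg _ _ hw0, mul_one, mul_div_cancel₀ _ h.ne', min_comm]
  have hθ1 : min 1 (S / w) ≤ 1 := min_le_left _ _
  have h1 : min 1 (S / w) * Q ≤ (∑ t ∈ T, min 1 ((bid t - volume.real (O t)) / w)) * Q :=
    mul_le_mul_of_nonneg_right hθ hQ0
  -- On `W` the own weights give at least Γw - Q and the impressions at least θQ, where Γ = 0.50005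
  -- and θ = min 1 (S / w). This inequality says that the total is at least θΓw.
  have h2 : (1 - min 1 (S / w)) * Q ≤ (1 - min 1 (S / w)) * (0.50005 * w) :=
    mul_le_mul_of_nonneg_left hQw (by linarith)
  rw [hmin, hownsplit]
  rw [hownU] at hsum
  nlinarith

end Trace

/-! ## Gains along a trace -/

namespace Trace

variable {β : ℝ} (τ : Trace β)

/-- The part of the gain at time `t` that goes to the impression. -/
def gain (t : ℕ) : ℝ :=
  (∫ y in τ.semi t, semiWeight (τ.cnt t y)) + 5 / 4 * ∫ y in τ.fix t, semiWeight (τ.cnt t y)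

lemma gain_nonneg (t : ℕ) : 0 ≤ τ.gain t := by
  have h1 : 0 ≤ ∫ y in τ.semi t, semiWeight (τ.cnt t y) :=
    integral_nonneg fun y => semiWeight_nonneg _
  have h2 : 0 ≤ ∫ y in τ.fix t, semiWeight (τ.cnt t y) :=
    integral_nonneg fun y => semiWeight_nonneg _
  unfold gain
  linarith

/-- The pointwise gain at time `t`. -/
def pointGain (t : ℕ) (y : ℝ) : ℝ :=
  (τ.semi t).indicator (fun y => semiWeight (τ.cnt t y)) y +
    5 / 4 * (τ.fix t).indicator (fun y => semiWeight (τ.cnt t y)) y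

/-- A surviving point pays its weights for counts 0, 1, 2, … in turn. A deterministic assignment
adds 5/4 of the current weight and ends the payments, so `sum_semiWeight_add_le` bounds the total.
-/
lemma sum_pointGain (n : ℕ) (y : ℝ) :
    (y ∉ τ.det n → ∑ t ∈ Finset.range n, τ.pointGain t y =
      ∑ l ∈ Finset.range (τ.cnt n y), semiWeight l) ∧
    (y ∈ τ.det n → ∑ t ∈ Finset.range n, τ.pointGain t y + 0.500392 ≤ 1) := by
  induction n with
  | zero => simp [τ.cnt_zero, τ.det_zero]
  | succ n ih =>
    rw [Finset.sum_range_succ, τ.det_succ]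
    refine ⟨fun h => ?_, fun h => ?_⟩
    · have h1 : y ∉ τ.det n := fun h' => h (Or.inl h')
      have h2 : y ∉ τ.fix n := fun h' => h (Or.inr h')
      rw [ih.1 h1, pointGain, indicator_of_notMem h2, mul_zero, add_zero]
      by_cases h3 : y ∈ τ.semi n
      · rw [indicator_of_mem h3, τ.cnt_succ_of_mem n y h3, Finset.sum_range_succ]
      · rw [indicator_of_notMem h3, τ.cnt_succ_of_notMem n y h3, add_zero]
    · by_cases h1 : y ∈ τ.det n
      · have h2 : y ∉ τ.semi n := fun h' => (τ.semi_subset n h').2 h1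
        have h3 : y ∉ τ.fix n := fun h' => (τ.fix_subset n h').2 h1
        rw [pointGain, indicator_of_notMem h2, indicator_of_notMem h3, mul_zero, add_zero, add_zero]
        exact ih.2 h1
      · have h2 := h.resolve_left h1
        have h3 : y ∉ τ.semi n := fun h' => τ.disjoint_semi_fix n y h' h2
        rw [ih.1 h1, pointGain, indicator_of_notMem h3, indicator_of_mem h2, zero_add]
        exact sum_semiWeight_add_le _

lemma integrable_own_and_gain (n : ℕ) (hcm : ∀ t, Measurable (τ.cnt t))
    (hdm : ∀ t, MeasurableSet (τ.det t)) (hsm : ∀ t, MeasurableSet (τ.semi t))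
    (hfm : ∀ t, MeasurableSet (τ.fix t)) :
    IntegrableOn (fun y => τ.own n y + ∑ t ∈ Finset.range n, τ.pointGain t y) (Ico 0 β) ∧
    ∫ y in Ico 0 β, (τ.own n y + ∑ t ∈ Finset.range n, τ.pointGain t y) =
      (∫ y in Ico 0 β, τ.own n y) + ∑ t ∈ Finset.range n, τ.gain t := by
  have h0 : IntegrableOn (τ.own n) (Ico 0 β) :=
    IntegrableOn.of_bound (volume_ne_top_of_subset_Ico subset_rfl).lt_top
      (τ.measurable_own n (hcm n) (hdm n)).aestronglyMeasurable 1
      (ae_of_all _ fun y => by rw [Real.norm_of_nonneg (τ.own_nonneg n y)]; exact τ.own_le n y)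
  have h1 : ∀ t, IntegrableOn (fun y => semiWeight (τ.cnt t y)) (Ico 0 β) := fun t =>
    integrableOn_comp_nat (hcm t) semiWeight_nonneg semiWeight_le
      (volume_ne_top_of_subset_Ico subset_rfl)
  have h2 : ∀ t, IntegrableOn (τ.pointGain t) (Ico 0 β) := fun t =>
    ((h1 t).indicator (hsm t)).add (((h1 t).indicator (hfm t)).const_mul _)
  have h3 : ∀ t, ∫ y in Ico 0 β, τ.pointGain t y = τ.gain t := by
    intro t
    simp only [pointGain, gain]
    rw [integral_add ((h1 t).indicator (hsm t)) (((h1 t).indicator (hfm t)).const_mul _),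
      integral_const_mul, setIntegral_indicator (hsm t), setIntegral_indicator (hfm t),
      inter_eq_self_of_subset_right ((τ.semi_subset t).trans sdiff_subset),
      inter_eq_self_of_subset_right ((τ.fix_subset t).trans sdiff_subset)]
  refine ⟨h0.add (integrable_finsetSum _ fun t _ => h2 t), ?_⟩
  rw [integral_add h0 (integrable_finsetSum _ fun t _ => h2 t),
    integral_finsetSum _ fun t _ => h2 t]
  simp only [h3]

end Trace

/-! ### Measurability of traces, and comparison of the pointwise gain with the PanOCS guarantee -/

section Measurability

variable {A : Type*} [DecidableEq A] (B : A → ℝ) (hB : ∀ a, 0 < B a) (R : List (Round A))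
  (hR : ∀ r ∈ R, r.Valid B) (a : A)

lemma panTrace_semi_fix_cases (t : ℕ) :
    ((panTrace B hB R hR a).semi t = ∅ ∨
      ∃ b, (panTrace B hB R hR a).semi t = (stateAfter B (R.take t)).nextSet B a b) ∧
    ((panTrace B hB R hR a).fix t = ∅ ∨
      ∃ b, (panTrace B hB R hR a).fix t = (stateAfter B (R.take t)).nextSet B a b) := by
  by_cases ht : t < R.length
  · simp only [panTrace, ht, exists_true_left]
    rcases round_cases B (stateAfter B (R.take t)) (hR _ (R.getElem_mem ht)) a with
      ⟨h1, h2, -⟩ | ⟨b, -, h1, h2, -⟩ | ⟨b, -, h1, h2, -⟩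
    · exact ⟨Or.inl (eq_empty_of_forall_notMem h1), Or.inl (eq_empty_of_forall_notMem h2)⟩
    · exact ⟨Or.inr ⟨b, Set.ext h1⟩, Or.inl (eq_empty_of_forall_notMem h2)⟩
    · exact ⟨Or.inl (eq_empty_of_forall_notMem h1), Or.inr ⟨b, Set.ext h2⟩⟩
  · exact ⟨Or.inl (eq_empty_of_forall_notMem fun y hy => ht hy.1),
      Or.inl (eq_empty_of_forall_notMem fun y hy => ht hy.1)⟩

lemma measurableSet_panTrace_det (t : ℕ) : MeasurableSet ((panTrace B hB R hR a).det t) := by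
  induction t with
  | zero => rw [Trace.det_zero]; exact MeasurableSet.empty
  | succ t ih =>
    rw [Trace.det_succ]
    refine ih.union ?_
    rcases (panTrace_semi_fix_cases B hB R hR a t).2 with h | ⟨b, h⟩
    · rw [h]; exact MeasurableSet.empty
    · rw [h]; exact measurableSet_scanSet ih b

lemma measurableSet_panTrace_semi (t : ℕ) : MeasurableSet ((panTrace B hB R hR a).semi t) := by
  rcases (panTrace_semi_fix_cases B hB R hR a t).1 with h | ⟨b, h⟩
  · rw [h]; exact MeasurableSet.empty
  · rw [h]; exact measurableSet_scanSet (measurableSet_panTrace_det B hB R hR a t) b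

lemma measurableSet_panTrace_fix (t : ℕ) : MeasurableSet ((panTrace B hB R hR a).fix t) := by
  rcases (panTrace_semi_fix_cases B hB R hR a t).2 with h | ⟨b, h⟩
  · rw [h]; exact MeasurableSet.empty
  · rw [h]; exact measurableSet_scanSet (measurableSet_panTrace_det B hB R hR a t) b

lemma measurable_panTrace_cnt (t : ℕ) : Measurable ((panTrace B hB R hR a).cnt t) := by
  classical
  induction t with
  | zero =>
    have : (panTrace B hB R hR a).cnt 0 = fun _ => 0 := funext fun y => Trace.cnt_zero _ y
    rw [this]; exact measurable_const
  | succ t ih =>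
    have : (panTrace B hB R hR a).cnt (t + 1) = fun y => (panTrace B hB R hR a).cnt t y +
        if y ∈ (panTrace B hB R hR a).semi t then 1 else 0 := by
      funext y
      split_ifs with h
      · exact Trace.cnt_succ_of_mem _ t y h
      · exact Trace.cnt_succ_of_notMem _ t y h
    rw [this]
    exact ih.add (Measurable.ite (measurableSet_panTrace_semi B hB R hR a t) measurable_const
      measurable_const)

lemma mem_panTrace_det_iff (y : ℝ) :
    y ∈ (panTrace B hB R hR a).det R.length ↔ ∃ s ∈ panoramicSteps B R, s.Assigns a y := by
  constructor
  · intro h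
    obtain ⟨t, ht, hy⟩ := Trace.exists_mem_fix_of_mem_det _ h
    obtain ⟨_, hy⟩ := hy
    rw [← getElem_panoramicSteps B R ht] at hy
    exact ⟨_, List.getElem_mem _, hy⟩
  · rintro ⟨s, hs, hy⟩
    obtain ⟨t, ht, rfl⟩ := List.getElem_of_mem hs
    rw [length_panoramicSteps] at ht
    rw [getElem_panoramicSteps B R ht] at hy
    refine Trace.det_mono _ (Nat.succ_le_of_lt ht) ?_
    rw [Nat.succ_eq_add_one, Trace.det_succ]
    exact Or.inr ⟨ht, hy⟩

/-- The pointwise gains are covered by the guarantee of a PanOCS. -/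
lemma own_add_sum_pointGain_le (y : ℝ) :
    (panTrace B hB R hR a).own R.length y +
      ∑ t ∈ Finset.range R.length, (panTrace B hB R hR a).pointGain t y ≤
    panocsBound (0.01245 / 18) (kValue (panoramicSteps B R) a y) := by
  set τ := panTrace B hB R hR a with hτ
  obtain ⟨h1, h2⟩ := τ.sum_pointGain R.length y
  have hiff := mem_panTrace_det_iff B hB R hR a y
  by_cases hy : y ∈ τ.det R.length
  · rw [kValue, if_pos (hiff.1 hy), Trace.own, if_pos hy]
    have := h2 hy
    simp only [panocsBound, if_true]
    linarith
  · rw [kValue, if_neg fun h => hy (hiff.2 h), Trace.own, if_neg hy, h1 hy, panocsBound,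
      if_neg (ENat.natCast_ne_top _), ENat.toNat_natCast]
    have hc : τ.cnt R.length y = semiCount (panoramicSteps B R) a y := by
      change semiCount (panoramicSteps B (R.take R.length)) a y = _
      rw [List.take_length]
    rw [hc, add_comm]
    exact sum_semiWeight_add_ownWeight_le _

end Measurability

/-! ## Planners -/

namespace Planner

variable {A : Type*} (plan : Planner A)

lemma rounds_append_singleton (I : List (A → ℝ)) (bid : A → ℝ) :
    plan.rounds (I ++ [bid]) = plan.rounds I ++ [plan (I ++ [bid])] := by
  simp only [Planner.rounds, List.length_append, List.length_singleton, List.range_succ,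
    List.map_append, List.map_singleton]
  congr 1
  · refine List.map_congr_left fun t ht => ?_
    rw [List.take_append_of_le_length (List.mem_range.1 ht)]
  · rw [List.take_of_length_le (by simp)]

lemma length_rounds (I : List (A → ℝ)) : (plan.rounds I).length = I.length := by
  simp [Planner.rounds]

lemma getElem_rounds (I : List (A → ℝ)) {t : ℕ} (ht : t < (plan.rounds I).length) :
    (plan.rounds I)[t] = plan (I.take (t + 1)) := by
  simp [Planner.rounds]

lemma take_rounds (I : List (A → ℝ)) (t : ℕ) :
    (plan.rounds I).take t = plan.rounds (I.take t) := by
  refine List.ext_getElem (by simp [length_rounds]) fun i h₁ h₂ => ?_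
  rw [List.length_take, length_rounds] at h₁
  rw [List.getElem_take, getElem_rounds, getElem_rounds, List.take_take, min_eq_left (by omega)]

end Planner

/-! ## The greedy planner -/

section Greedy

variable {A : Type*} [Fintype A] [DecidableEq A] [Nonempty A] (B : A → ℝ)

lemma exists_dominant_or_pair (v : A → ℝ) :
    (∃ a, ∀ a' ≠ a, 4 * v a' ≤ v a) ∨
      ∃ a₁ a₂, a₁ ≠ a₂ ∧ v a₂ ≤ v a₁ ∧ v a₁ < 4 * v a₂ ∧ ∀ a ≠ a₁, v a ≤ v a₂ := by
  obtain ⟨a₁, h₁⟩ := Finite.exists_max v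
  by_cases h : ∀ a' ≠ a₁, 4 * v a' ≤ v a₁
  · exact Or.inl ⟨a₁, h⟩
  · push Not at h
    obtain ⟨a', hne, hlt⟩ := h
    obtain ⟨a₂, ha₂, h₂⟩ := Finset.exists_max_image (Finset.univ.erase a₁) v
      ⟨a', by simp [hne]⟩
    refine Or.inr ⟨a₁, a₂, (Finset.ne_of_mem_erase ha₂).symm, h₁ a₂, ?_, fun a ha => ?_⟩
    · linarith [h₂ a' (by simp [hne])]
    · exact h₂ a (by simp [ha])

/-- The subset that advertiser `a` would get for its bid after the rounds `R`. -/
def offer (R : List (Round A)) (bid : A → ℝ) (a : A) : Set ℝ :=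
  (stateAfter B R).nextSet B a (min (bid a) (B a))

/-- The gain of the impression from a semi-assignment of the offered subset. -/
def offerValue (R : List (Round A)) (bid : A → ℝ) (a : A) : ℝ :=
  ∫ y in offer B R bid a, semiWeight (semiCount (panoramicSteps B R) a y)

lemma offerValue_nonneg (R : List (Round A)) (bid : A → ℝ) (a : A) : 0 ≤ offerValue B R bid a :=
  integral_nonneg fun _ => semiWeight_nonneg _

/-- The round is deterministic if one offer is worth at least four times any other one, and
semi-assigns the two best offers otherwise. -/
def IsGreedyRound (R : List (Round A)) (bid : A → ℝ) (r : Round A) : Prop :=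
  (∃ a, r = .det a (min (bid a) (B a)) ∧
    ∀ a' ≠ a, 4 * offerValue B R bid a' ≤ offerValue B R bid a) ∨
  ∃ a₁ a₂, r = .rand a₁ (min (bid a₁) (B a₁)) a₂ (min (bid a₂) (B a₂)) ∧ a₁ ≠ a₂ ∧
    offerValue B R bid a₂ ≤ offerValue B R bid a₁ ∧
    offerValue B R bid a₁ < 4 * offerValue B R bid a₂ ∧
    ∀ a ≠ a₁, offerValue B R bid a ≤ offerValue B R bid a₂

lemma exists_isGreedyRound (R : List (Round A)) (bid : A → ℝ) : ∃ r, IsGreedyRound B R bid r := by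
  rcases exists_dominant_or_pair (offerValue B R bid) with ⟨a, h⟩ | ⟨a₁, a₂, h⟩
  · exact ⟨_, Or.inl ⟨a, rfl, h⟩⟩
  · exact ⟨_, Or.inr ⟨a₁, a₂, rfl, h⟩⟩

/-- A greedy round for the bids `bid` after the rounds `R`. -/
def greedyRound (R : List (Round A)) (bid : A → ℝ) : Round A :=
  (exists_isGreedyRound B R bid).choose

/-- The planner that makes greedy choices. -/
def greedyPlanner : Planner A := fun l =>
  -- The fold recomputes the earlier rounds from the earlier bids. The default bid 0 below matters
  -- only for the empty list.
  greedyRound B (l.dropLast.foldl (fun R bid => R ++ [greedyRound B R bid]) [])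
    (l.getLast?.getD 0)

lemma rounds_greedyPlanner (I : List (A → ℝ)) :
    (greedyPlanner B).rounds I = I.foldl (fun R bid => R ++ [greedyRound B R bid]) [] := by
  induction I using List.reverseRecOn with
  | nil => rfl
  | append_singleton I bid ih =>
    rw [Planner.rounds_append_singleton, ih, List.foldl_append]
    simp [greedyPlanner]

lemma greedyPlanner_append_singleton (I : List (A → ℝ)) (bid : A → ℝ) :
    greedyPlanner B (I ++ [bid]) = greedyRound B ((greedyPlanner B).rounds I) bid := by
  rw [rounds_greedyPlanner]
  simp [greedyPlanner]

lemma isGreedyRound_getElem (I : List (A → ℝ)) {t : ℕ} (ht : t < I.length) :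
    IsGreedyRound B (((greedyPlanner B).rounds I).take t) I[t]
      (((greedyPlanner B).rounds I)[t]'(by rw [Planner.length_rounds]; exact ht)) := by
  have h : (greedyPlanner B) (I.take (t + 1)) =
      greedyRound B (((greedyPlanner B).rounds I).take t) I[t] := by
    rw [Planner.take_rounds, take_succ_eq I ht, greedyPlanner_append_singleton]
  rw [Planner.getElem_rounds, h]
  exact (exists_isGreedyRound B _ _).choose_spec

variable {B}

lemma IsGreedyRound.valid (hB : ∀ a, 0 < B a) {R : List (Round A)} {bid : A → ℝ} {r : Round A}
    (h : IsGreedyRound B R bid r) (hbid : ∀ a, 0 ≤ bid a) : r.Valid B := by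
  have hm : ∀ a, 0 ≤ min (bid a) (B a) ∧ min (bid a) (B a) ≤ B a := fun a =>
    ⟨le_min (hbid a) (hB a).le, min_le_right _ _⟩
  rcases h with ⟨a, rfl, -⟩ | ⟨a₁, a₂, rfl, hne, -⟩
  · exact hm a
  · exact ⟨hne, hm a₁, hm a₂⟩

lemma IsGreedyRound.respectsBids {R : List (Round A)} {bid : A → ℝ} {r : Round A}
    (h : IsGreedyRound B R bid r) : r.RespectsBids bid := by
  rcases h with ⟨a, rfl, -⟩ | ⟨a₁, a₂, rfl, -⟩
  · exact min_le_left _ _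
  · exact ⟨min_le_left _ _, min_le_left _ _⟩

end Greedy

/-! ## Analysis of the greedy planner -/

section Analysis

variable {A : Type*} [Fintype A] [DecidableEq A] [Nonempty A] {B : A → ℝ} (hB : ∀ a, 0 < B a)

section Rounds

variable (R : List (Round A)) (hR : ∀ r ∈ R, r.Valid B)

lemma panTrace_fix_of_det {t : ℕ} (ht : t < R.length) {a : A} {b : ℝ} (h : R[t] = .det a b) :
    (panTrace B hB R hR a).fix t = (stateAfter B (R.take t)).nextSet B a b := by
  ext y
  simp [panTrace, ht, h, PanState.step, Step.Assigns]

lemma panTrace_semi_of_rand {t : ℕ} (ht : t < R.length) {a₁ a₂ : A} {b₁ b₂ : ℝ}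
    (h : R[t] = .rand a₁ b₁ a₂ b₂) (hne : a₁ ≠ a₂) :
    (panTrace B hB R hR a₁).semi t = (stateAfter B (R.take t)).nextSet B a₁ b₁ ∧
      (panTrace B hB R hR a₂).semi t = (stateAfter B (R.take t)).nextSet B a₂ b₂ := by
  constructor <;> ext y <;> simp [panTrace, ht, h, PanState.step, Step.SemiAssigns, hne, hne.symm]

lemma exists_of_mem_panTrace_semi {t : ℕ} {a : A} {y : ℝ} (hy : y ∈ (panTrace B hB R hR a).semi t) :
    ∃ ht : t < R.length, ∃ a₁ b₁ a₂ b₂, R[t] = .rand a₁ b₁ a₂ b₂ ∧ (a₁ = a ∨ a₂ = a) := by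
  obtain ⟨ht, hy⟩ := hy
  refine ⟨ht, ?_⟩
  cases h : R[t] with
  | det a b => rw [h] at hy; exact absurd hy (by simp [PanState.step, Step.SemiAssigns])
  | rand a₁ b₁ a₂ b₂ =>
    rw [h] at hy
    exact ⟨a₁, b₁, a₂, b₂, rfl, hy.imp And.left And.left⟩

/-- The dual value of the impression of time `t`. -/
def totalGain (t : ℕ) : ℝ := ∑ a, (panTrace B hB R hR a).gain t

lemma gain_le_totalGain (t : ℕ) (a : A) : (panTrace B hB R hR a).gain t ≤ totalGain hB R hR t :=
  Finset.single_le_sum (f := fun a => (panTrace B hB R hR a).gain t)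
    (fun _ _ => Trace.gain_nonneg _ t) (Finset.mem_univ a)

lemma gain_add_gain_le_totalGain (t : ℕ) {a₁ a₂ : A} (h : a₁ ≠ a₂) :
    (panTrace B hB R hR a₁).gain t + (panTrace B hB R hR a₂).gain t ≤ totalGain hB R hR t := by
  rw [← Finset.sum_pair (f := fun a => (panTrace B hB R hR a).gain t) h]
  exact Finset.sum_le_sum_of_subset_of_nonneg (Finset.subset_univ _)
    fun a _ _ => Trace.gain_nonneg _ t

lemma semi_integral_le_gain {β : ℝ} (τ : Trace β) (t : ℕ) :
    ∫ y in τ.semi t, semiWeight (τ.cnt t y) ≤ τ.gain t := by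
  have h2 : 0 ≤ ∫ y in τ.fix t, semiWeight (τ.cnt t y) :=
    integral_nonneg fun y => semiWeight_nonneg _
  unfold Trace.gain
  linarith

lemma fix_integral_le_gain {β : ℝ} (τ : Trace β) (t : ℕ) :
    5 / 4 * ∫ y in τ.fix t, semiWeight (τ.cnt t y) ≤ τ.gain t := by
  have h2 : 0 ≤ ∫ y in τ.semi t, semiWeight (τ.cnt t y) :=
    integral_nonneg fun y => semiWeight_nonneg _
  unfold Trace.gain
  linarith

/-- The dual value of an impression that gets a greedy round. -/
lemma IsGreedyRound.value_cases {t : ℕ} (ht : t < R.length) {bid : A → ℝ}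
    (h : IsGreedyRound B (R.take t) bid R[t]) (a : A) :
    (panTrace B hB R hR a).fix t = offer B (R.take t) bid a ∨
    ((panTrace B hB R hR a).semi t = offer B (R.take t) bid a ∧
      5 / 4 * offerValue B (R.take t) bid a ≤ totalGain hB R hR t) ∨
    2 * offerValue B (R.take t) bid a ≤ totalGain hB R hR t := by
  have h0 := offerValue_nonneg B (R.take t) bid
  rcases h with ⟨a₁, h1, h2⟩ | ⟨a₁, a₂, h1, hne, h2, h3, h4⟩
  · have hfix := panTrace_fix_of_det hB R hR ht h1
    by_cases ha : a = a₁
    · subst ha; exact Or.inl hfix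
    · right; right
      have h5 := (fix_integral_le_gain (panTrace B hB R hR a₁) t).trans
        (gain_le_totalGain hB R hR t a₁)
      rw [hfix] at h5
      change 5 / 4 * offerValue B (R.take t) bid a₁ ≤ _ at h5
      -- The dual value is at least 5/4 of the winning offer, hence at least 5 times any rejected
      -- one.
      linarith [h2 a ha, h0 a, h0 a₁]
  · obtain ⟨hs1, hs2⟩ := panTrace_semi_of_rand hB R hR ht h1 hne
    have h5 := gain_add_gain_le_totalGain hB R hR t hne
    have h6 := semi_integral_le_gain (panTrace B hB R hR a₁) t
    have h7 := semi_integral_le_gain (panTrace B hB R hR a₂) t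
    rw [hs1] at h6
    rw [hs2] at h7
    change offerValue B (R.take t) bid a₁ ≤ _ at h6
    change offerValue B (R.take t) bid a₂ ≤ _ at h7
    by_cases ha1 : a = a₁
    · subst ha1; exact Or.inr (Or.inl ⟨hs1, by linarith⟩)
    · by_cases ha2 : a = a₂
      · subst ha2; exact Or.inr (Or.inl ⟨hs2, by linarith⟩)
      · exact Or.inr (Or.inr (by linarith [h4 a ha1]))

/-- Greedy rounds never semi-assign a point more than twelve times. -/
lemma semiCount_le_of_greedy (hB : ∀ a, 0 < B a) (hR : ∀ r ∈ R, r.Valid B) {bids : ℕ → A → ℝ}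
    (h : ∀ t (ht : t < R.length), IsGreedyRound B (R.take t) (bids t) R[t]) (a : A) (y : ℝ) :
    semiCount (panoramicSteps B R) a y ≤ 12 := by
  set τ := panTrace B hB R hR a with hτ
  by_contra! hcon
  have hcnt : τ.cnt R.length y = semiCount (panoramicSteps B R) a y := by
    change semiCount (panoramicSteps B (R.take R.length)) a y = _
    rw [List.take_length]
  obtain ⟨t, -, hy, h12⟩ := τ.exists_semi_of_lt_cnt (hcnt.symm ▸ hcon)
  -- A thirteenth semi-assignment would start from count 12. Then all scanned points have count at
  -- least 11 and the offer is worthless, whereas both offers of a greedy randomized round have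
  -- positive value.
  have hzero : ∫ z in τ.semi t, semiWeight (τ.cnt t z) = 0 := by
    refine setIntegral_eq_zero_of_forall_eq_zero fun z hz => semiWeight_of_ge ?_
    have := τ.spread t y (τ.semi_subset t hy) z (τ.semi_subset t hz)
    omega
  obtain ⟨ht, c₁, d₁, c₂, d₂, hr, hor⟩ := exists_of_mem_panTrace_semi hB R hR hy
  rcases h t ht with ⟨a₁, h1, h2⟩ | ⟨a₁, a₂, h1, hne, h2, h3, -⟩
  · rw [h1] at hr; exact absurd hr (by simp)
  · obtain ⟨hs1, hs2⟩ := panTrace_semi_of_rand hB R hR ht h1 hne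
    rw [h1] at hr
    obtain ⟨rfl, -, rfl, -⟩ : a₁ = c₁ ∧ _ ∧ a₂ = c₂ ∧ _ := by simpa using hr
    have h0 := offerValue_nonneg B (R.take t) (bids t)
    rcases hor with rfl | rfl
    · rw [hτ, hs1] at hzero
      change offerValue B (R.take t) (bids t) a₁ = 0 at hzero
      linarith [h0 a₂]
    · rw [hτ, hs2] at hzero
      change offerValue B (R.take t) (bids t) a₂ = 0 at hzero
      linarith [h0 a₁]

/-- The offline optimum is bounded by the dual value of a greedy run. -/
lemma payoff_le_of_greedy (I : List (A → ℝ)) (hI : ∀ bid ∈ I, ∀ a, 0 ≤ bid a)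
    (hlen : R.length = I.length)
    (h : ∀ t (ht : t < R.length), IsGreedyRound B (R.take t) (I[t]'(hlen ▸ ht)) R[t])
    (f : Fin I.length → A) :
    0.50005 * payoff B I f ≤ ∑ a, ((∫ y in Ico 0 (B a), (panTrace B hB R hR a).own R.length y) +
      ∑ t ∈ Finset.range R.length, (panTrace B hB R hR a).gain t) := by
  set T : A → Finset ℕ := fun a =>
    (Finset.univ.filter fun t => f t = a).map Fin.valEmbedding with hT
  have hTlt : ∀ a, ∀ t ∈ T a, t < R.length := by
    intro a t ht
    simp only [hT, Finset.mem_map, Finset.mem_filter] at ht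
    obtain ⟨s, -, rfl⟩ := ht
    rw [hlen]; exact s.2
  have hbids : ∀ t (ht : t < R.length), I.getD t 0 = I[t]'(hlen ▸ ht) := fun t ht => by
    rw [List.getD_eq_getElem]
  have hstart : ∀ a t, (stateAfter B (R.take t)).start a ∈ Ico 0 (B a) := fun a t =>
    (isLevel_stateAfter B hB a _ fun r hr => hR r (List.mem_of_mem_take hr)).1
  have key : ∀ a, 0.50005 * min (∑ t with f t = a, I[t] a) (B a) ≤
      (∫ y in Ico 0 (B a), (panTrace B hB R hR a).own R.length y) +
        ∑ t with f t = a, totalGain hB R hR t := by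
    intro a
    have := (panTrace B hB R hR a).dual_feasible R.length (measurable_panTrace_cnt B hB R hR a)
      (measurableSet_panTrace_det B hB R hR a) (fun t => offer B (R.take t) (I.getD t 0) a)
      (fun t => I.getD t 0 a) (totalGain hB R hR) (T a) (hTlt a)
      (fun t _ => measurableSet_scanSet (measurableSet_panTrace_det B hB R hR a t) _)
      (fun t _ => scanSet_subset _ _ _ _)
      (fun t _ y hy z hz hz' => (isLevel_stateAfter B hB a _ fun r hr =>
        hR r (List.mem_of_mem_take hr)).2.le_of_mem_scanSet hy hz hz') ?_ ?_ (hB a)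
    · simpa [hT, Finset.sum_map] using this
    · intro t ht
      have hnn : 0 ≤ I.getD t 0 a := by
        rw [hbids t (hTlt a t ht)]; exact hI _ (List.getElem_mem _) a
      refine (volume_scanSet (hB a) (hstart a t) (le_min hnn (hB a).le)).trans ?_
      -- Capping the bid at the budget is immaterial, since the available measure never exceeds the
      -- budget.
      rw [min_assoc]
      congr 1
      refine min_eq_right ((measureReal_mono sdiff_subset
        (volume_ne_top_of_subset_Ico subset_rfl)).trans ?_)
      simp [(hB a).le]
    · intro t ht
      have ht' := hTlt a t ht
      have hg := h t ht'
      rw [← hbids t ht'] at hg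
      rcases hg.value_cases hB R hR ht' a with h1 | h1 | h1
      · exact Or.inl ⟨h1, Finset.sum_nonneg fun a _ => Trace.gain_nonneg _ t⟩
      · exact Or.inr (Or.inl h1)
      · exact Or.inr (Or.inr h1)
  rw [payoff, Finset.mul_sum]
  refine (Finset.sum_le_sum fun a _ => key a).trans (le_of_eq ?_)
  rw [Finset.sum_add_distrib, Finset.sum_add_distrib,
    Finset.sum_fiberwise (g := f) (f := fun t : Fin I.length => totalGain hB R hR t),
    Finset.sum_comm (s := Finset.univ (α := A)), hlen, Finset.sum_range]
  rfl

end Rounds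

end Analysis

/-! ## The expected payoff of the combined algorithm -/

section Payoff

variable {A : Type*} [Fintype A] [DecidableEq A] [Nonempty A] {B : A → ℝ}

lemma combine_act_eq (plan : Planner A) (P : PairSelector A) (I : List (A → ℝ)) (ω : P.Seed)
    {t : ℕ} (ht : t < (panoramicSteps B (plan.rounds I)).length) :
    (plan.combine B P).act ω (I.take (t + 1)) =
      (outcome P (panoramicSteps B (plan.rounds I)) ω ⟨t, ht⟩).1 := by
  have hR : t < (plan.rounds I).length := by rwa [length_panoramicSteps] at ht
  have h1 := getElem_panoramicSteps B (plan.rounds I) hR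
  rw [Planner.getElem_rounds] at h1
  have h2 : panoramicSteps B (plan.rounds (I.take (t + 1))) =
      (panoramicSteps B (plan.rounds I)).take (t + 1) := by
    rw [take_panoramicSteps, Planner.take_rounds]
  simp only [Planner.combine, outcome, Fin.getElem_fin, h1, h2]
  cases plan (I.take (t + 1)) with
  | det a b => rfl
  | rand a₁ b₁ a₂ b₂ =>
    simp only [PanState.step]
    split_ifs <;> rfl

lemma measurableSet_nextSet (hB : ∀ a, 0 < B a) {R : List (Round A)} (hR : ∀ r ∈ R, r.Valid B)
    (a : A) (b : ℝ) : MeasurableSet ((stateAfter B R).nextSet B a b) := by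
  have h := measurableSet_panTrace_det B hB R hR a R.length
  change MeasurableSet ((stateAfter B (R.take R.length)).assigned a) at h
  rw [List.take_length] at h
  exact measurableSet_scanSet h b

/-- The points of advertiser `a` that are assigned for the seed `ω`. -/
def assignedSet (P : PairSelector A) (T : List (Step A)) (a : A) (ω : P.Seed) : Set ℝ :=
  {y | ∃ t : Fin T.length, (outcome P T ω t).1 = a ∧ y ∈ (outcome P T ω t).2}

lemma measurableSet_assigned (hB : ∀ a, 0 < B a) (P : PairSelector A) {R : List (Round A)}
    (hR : ∀ r ∈ R, r.Valid B) (a : A) :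
    MeasurableSet {p : P.Seed × ℝ | p.2 ∈ assignedSet P (panoramicSteps B R) a p.1} := by
  have : {p : P.Seed × ℝ | p.2 ∈ assignedSet P (panoramicSteps B R) a p.1} =
      ⋃ t : Fin (panoramicSteps B R).length, {p : P.Seed × ℝ |
        (outcome P (panoramicSteps B R) p.1 t).1 = a ∧
        p.2 ∈ (outcome P (panoramicSteps B R) p.1 t).2} := by
    ext p; simp [assignedSet]
  rw [this]
  refine MeasurableSet.iUnion fun t => ?_
  have ht : (t : ℕ) < R.length := by rw [← length_panoramicSteps B R]; exact t.2
  have h1 := getElem_panoramicSteps B R ht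
  have hm := fun a b => measurableSet_nextSet hB (R := R.take t)
    (fun r hr => hR r (List.mem_of_mem_take hr)) a b
  simp only [outcome, Fin.getElem_fin, h1]
  cases R[(t : ℕ)] with
  | det a' b =>
    exact (MeasurableSet.const (a' = a)).inter (measurable_snd (hm a' b))
  | rand a₁ b₁ a₂ b₂ =>
    simp only [PanState.step]
    have hact : MeasurableSet {p : P.Seed × ℝ |
        P.act p.1 (randomizedPairs ((panoramicSteps B R).take (t + 1))) = true} :=
      measurable_fst (P.measurableSet_act _ true)
    convert (hact.inter ((MeasurableSet.const (a₁ = a)).inter (measurable_snd (hm a₁ b₁)))).union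
      (hact.compl.inter ((MeasurableSet.const (a₂ = a)).inter (measurable_snd (hm a₂ b₂)))) using 1
    ext p
    simp only [mem_ofPred_eq, mem_union, mem_inter_iff, mem_compl_iff, mem_preimage]
    split_ifs with h <;> simp [h]

/-- The expected measure of the assigned points is the integral of the assignment probabilities. -/
lemma integral_assignProb (hB : ∀ a, 0 < B a) (P : PairSelector A) {R : List (Round A)}
    (hR : ∀ r ∈ R, r.Valid B) (a : A) :
    IntegrableOn (assignProb P (panoramicSteps B R) a) (Ico 0 (B a)) ∧
    Integrable (fun ω => (volume.restrict (Ico 0 (B a))).real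
      (assignedSet P (panoramicSteps B R) a ω)) P.law ∧
    ∫ y in Ico 0 (B a), assignProb P (panoramicSteps B R) a y =
      ∫ ω, (volume.restrict (Ico 0 (B a))).real (assignedSet P (panoramicSteps B R) a ω) ∂P.law := by
  have hS := measurableSet_assigned hB P hR a
  set S := {p : P.Seed × ℝ | p.2 ∈ assignedSet P (panoramicSteps B R) a p.1} with hSdef
  have hint : Integrable (S.indicator fun _ => (1 : ℝ)) (P.law.prod (volume.restrict (Ico 0 (B a)))) :=
    (integrable_const 1).indicator hS
  have h1 : ∀ ω, ∫ y in Ico 0 (B a), S.indicator (fun _ => (1 : ℝ)) (ω, y) =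
      (volume.restrict (Ico 0 (B a))).real (assignedSet P (panoramicSteps B R) a ω) := fun ω =>
    integral_indicator_one (measurable_prodMk_left hS)
  have h2 : ∀ y, ∫ ω, S.indicator (fun _ => (1 : ℝ)) (ω, y) ∂P.law =
      assignProb P (panoramicSteps B R) a y := fun y =>
    integral_indicator_one (μ := P.law) (measurable_prodMk_right (y := y) hS)
  refine ⟨?_, ?_, ?_⟩
  · have := hint.integral_prod_right
    simp only [h2] at this
    exact this
  · have := hint.integral_prod_left
    simpa only [h1] using this
  -- Fubini for the indicator of the pairs (seed, assigned point), whose two sections give the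
  -- assigned measure and the assignment probability.
  · have := integral_integral_swap (f := fun ω y => S.indicator (fun _ => (1 : ℝ)) (ω, y)) hint
    simp only [h1, h2] at this
    exact this.symm

lemma volume_outcome_le (hB : ∀ a, 0 < B a) (P : PairSelector A) {R : List (Round A)}
    (hR : ∀ r ∈ R, r.Valid B) (ω : P.Seed) {t : ℕ} (ht : t < (panoramicSteps B R).length)
    {bid : A → ℝ} (hbid : (R[t]'(by rwa [length_panoramicSteps] at ht)).RespectsBids bid) :
    volume.real (outcome P (panoramicSteps B R) ω ⟨t, ht⟩).2 ≤
      bid (outcome P (panoramicSteps B R) ω ⟨t, ht⟩).1 := by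
  have ht' : t < R.length := by rwa [length_panoramicSteps] at ht
  have h1 := getElem_panoramicSteps B R ht'
  have hval := hR _ (List.getElem_mem ht')
  have hvol : ∀ a b, 0 ≤ b → volume.real ((stateAfter B (R.take t)).nextSet B a b) ≤ b :=
    fun a b hb => (volume_scanSet (hB a) (isLevel_stateAfter B hB a _ fun r hr =>
      hR r (List.mem_of_mem_take hr)).1 hb).trans_le (min_le_left _ _)
  simp only [outcome, Fin.getElem_fin, h1]
  generalize R[t] = r at *
  cases r with
  | det a b => exact (hvol a b hval.1).trans hbid
  | rand a₁ b₁ a₂ b₂ =>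
    simp only [PanState.step]
    split_ifs
    · exact (hvol a₁ b₁ hval.2.1.1).trans hbid.1
    · exact (hvol a₂ b₂ hval.2.2.1).trans hbid.2

lemma volume_outcome_ne_top (P : PairSelector A) (R : List (Round A)) (ω : P.Seed)
    (t : Fin (panoramicSteps B R).length) :
    volume (outcome P (panoramicSteps B R) ω t).2 ≠ ⊤ := by
  have ht' : (t : ℕ) < R.length := by rw [← length_panoramicSteps B R]; exact t.2
  have h1 := getElem_panoramicSteps B R ht'
  have hvol : ∀ a b, volume ((stateAfter B (R.take t)).nextSet B a b) ≠ ⊤ := fun a b =>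
    volume_ne_top_of_subset_Ico ((scanSet_subset _ _ _ _).trans sdiff_subset)
  simp only [outcome, Fin.getElem_fin, h1]
  cases R[(t : ℕ)] with
  | det a b => exact hvol a b
  | rand a₁ b₁ a₂ b₂ =>
    simp only [PanState.step]
    split_ifs
    · exact hvol a₁ b₁
    · exact hvol a₂ b₂

/-- The measure of the assigned points is at most the payment. -/
lemma sum_volume_assignedSet_le (hB : ∀ a, 0 < B a) (plan : Planner A) (P : PairSelector A)
    (I : List (A → ℝ)) (hR : ∀ r ∈ plan.rounds I, r.Valid B)
    (hbid : ∀ t : Fin I.length, (plan (I.take (t + 1))).RespectsBids I[t]) (ω : P.Seed) :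
    ∑ a, (volume.restrict (Ico 0 (B a))).real
        (assignedSet P (panoramicSteps B (plan.rounds I)) a ω) ≤
      payoff B I fun t => (plan.combine B P).act ω (I.take (t + 1)) := by
  refine Finset.sum_le_sum fun a _ => le_min ?_ ?_
  · have hlen : (panoramicSteps B (plan.rounds I)).length = I.length := by
      rw [length_panoramicSteps, Planner.length_rounds]
    set T := panoramicSteps B (plan.rounds I) with hT
    have hsub : assignedSet P T a ω ⊆ ⋃ t ∈ (Finset.univ : Finset (Fin T.length)).filter
        fun t => (outcome P T ω t).1 = a, (outcome P T ω t).2 := by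
      rintro y ⟨t, h1, h2⟩
      simp only [mem_iUnion]
      exact ⟨t, by simpa using h1, h2⟩
    have hfin : ∀ s : Finset (Fin T.length), volume (⋃ t ∈ s, (outcome P T ω t).2) ≠ ⊤ := fun s =>
      ((measure_biUnion_finset_le s _).trans_lt
        (ENNReal.sum_lt_top.2 fun t _ => (volume_outcome_ne_top P _ ω t).lt_top)).ne
    calc (volume.restrict (Ico 0 (B a))).real (assignedSet P T a ω)
        ≤ volume.real (⋃ t ∈ (Finset.univ : Finset (Fin T.length)).filter
            fun t => (outcome P T ω t).1 = a, (outcome P T ω t).2) :=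
          ENNReal.toReal_mono (hfin _)
            ((Measure.le_iff'.1 Measure.restrict_le_self _).trans (measure_mono hsub))
      _ ≤ ∑ t with (outcome P T ω t).1 = a, volume.real (outcome P T ω t).2 :=
          measureReal_biUnion_finset_le _ _
      _ ≤ ∑ t with (outcome P T ω t).1 = a, (I[(t : ℕ)]'(hlen ▸ t.2)) a := by
          refine Finset.sum_le_sum fun t ht => ?_
          rw [Finset.mem_filter] at ht
          have := volume_outcome_le hB P hR ω t.2 (bid := I[(t : ℕ)]'(hlen ▸ t.2)) (by
            rw [Planner.getElem_rounds]; exact hbid ⟨t, hlen ▸ t.2⟩)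
          refine this.trans (le_of_eq ?_)
          rw [← ht.2]
      _ = _ := by
          rw [Finset.sum_filter, Finset.sum_filter]
          refine Fintype.sum_equiv (finCongr hlen) _ _ fun t => ?_
          change _ = if (plan.combine B P).act ω (I.take (t + 1)) = a then I[(t : ℕ)] a else 0
          rw [combine_act_eq plan P I ω t.2]
  · refine (measureReal_mono (subset_univ _)).trans ?_
    simp [(hB a).le]

/-- There are only finitely many assignments, so the payoff is a bounded function of a measurable
discrete random variable. -/
lemma integrable_payoff (alg : OnlineAlgorithm (A → ℝ) A) (I : List (A → ℝ)) :
    Integrable (fun ω => payoff B I fun t => alg.act ω (I.take (t + 1))) alg.law := by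
  let _ : MeasurableSpace (Fin I.length → A) := ⊤
  have hF : Measurable fun (ω : alg.Seed) (t : Fin I.length) => alg.act ω (I.take (t + 1)) := by
    refine measurable_to_countable' fun x => ?_
    have : (fun (ω : alg.Seed) (t : Fin I.length) => alg.act ω (I.take (t + 1))) ⁻¹' {x} =
        ⋂ t : Fin I.length, {ω | alg.act ω (I.take (t + 1)) = x t} := by
      ext ω; simp [funext_iff]
    rw [this]
    exact MeasurableSet.iInter fun t => alg.measurableSet_act _ _
  have hg : Measurable (payoff B I) := measurable_from_top
  refine Integrable.of_bound (hg.comp hF).aestronglyMeasurable (∑ f, |payoff B I f|)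
    (ae_of_all _ fun ω => ?_)
  exact Finset.single_le_sum (f := fun f => |payoff B I f|) (fun f _ => abs_nonneg _)
    (Finset.mem_univ _)

/-- Following an admissible plan yields at least the dual value. -/
lemma dual_le_payoff (hB : ∀ a, 0 < B a) (plan : Planner A) (P : PairSelector A)
    (hP : IsPanOCS B 18 (0.01245 / 18) P) (I : List (A → ℝ))
    (hR : ∀ r ∈ plan.rounds I, r.Valid B)
    (hbid : ∀ t : Fin I.length, (plan (I.take (t + 1))).RespectsBids I[t])
    (hcap : ∀ a, ∀ y ∈ Ico 0 (B a), semiCount (panoramicSteps B (plan.rounds I)) a y ≤ 18) :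
    ∑ a, ((∫ y in Ico 0 (B a), (panTrace B hB _ hR a).own (plan.rounds I).length y) +
      ∑ t ∈ Finset.range (plan.rounds I).length, (panTrace B hB _ hR a).gain t) ≤
    ∫ ω, payoff B I (fun t => (plan.combine B P).act ω (I.take (t + 1))) ∂P.law := by
  have h1 := integral_assignProb hB P hR
  calc _ ≤ ∑ a, ∫ y in Ico 0 (B a), assignProb P (panoramicSteps B (plan.rounds I)) a y := by
        refine Finset.sum_le_sum fun a _ => ?_
        obtain ⟨h2, h3⟩ := (panTrace B hB _ hR a).integrable_own_and_gain (plan.rounds I).length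
          (measurable_panTrace_cnt B hB _ hR a) (measurableSet_panTrace_det B hB _ hR a)
          (measurableSet_panTrace_semi B hB _ hR a) (measurableSet_panTrace_fix B hB _ hR a)
        rw [← h3]
        -- The PanOCS guarantee enters here, pointwise; the later steps only compare assigned
        -- measure with payments.
        exact setIntegral_mono_on h2 (h1 a).1 measurableSet_Ico fun y hy =>
          (own_add_sum_pointGain_le B hB _ hR a y).trans (hP.2 _ hR hcap a y hy)
    _ = ∫ ω, ∑ a, (volume.restrict (Ico 0 (B a))).real
          (assignedSet P (panoramicSteps B (plan.rounds I)) a ω) ∂P.law := by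
        rw [integral_finsetSum _ fun a _ => (h1 a).2.1]
        exact Finset.sum_congr rfl fun a _ => (h1 a).2.2
    _ ≤ _ := integral_mono (integrable_finsetSum _ fun a _ => (h1 a).2.1)
        (integrable_payoff (plan.combine B P) I)
        fun ω => sum_volume_assignedSet_le hB plan P I hR hbid ω

lemma greedyPlanner_valid (hB : ∀ a, 0 < B a) {I : List (A → ℝ)}
    (hI : ∀ bid ∈ I, ∀ a, 0 ≤ bid a) : ∀ r ∈ (greedyPlanner B).rounds I, r.Valid B := by
  intro r hr
  obtain ⟨t, ht, rfl⟩ := List.getElem_of_mem hr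
  rw [Planner.length_rounds] at ht
  exact (isGreedyRound_getElem B I ht).valid hB (hI _ (List.getElem_mem ht))

lemma greedyPlanner_semiCount_le (hB : ∀ a, 0 < B a) {I : List (A → ℝ)}
    (hI : ∀ bid ∈ I, ∀ a, 0 ≤ bid a) (a : A) (y : ℝ) :
    semiCount (panoramicSteps B ((greedyPlanner B).rounds I)) a y ≤ 18 := by
  refine (semiCount_le_of_greedy _ hB (greedyPlanner_valid hB hI) (bids := fun t => I.getD t 0)
    (fun t ht => ?_) a y).trans (by norm_num)
  rw [Planner.length_rounds] at ht
  have := isGreedyRound_getElem B I ht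
  rwa [← List.getD_eq_getElem I 0 ht] at this

lemma greedyPlanner_respectsBids (I : List (A → ℝ)) (t : Fin I.length) :
    ((greedyPlanner B) (I.take (t + 1))).RespectsBids I[t] := by
  have := (isGreedyRound_getElem B I t.2).respectsBids
  rwa [Planner.getElem_rounds] at this

lemma greedyPlanner_admissible (hB : ∀ a, 0 < B a) : (greedyPlanner B).Admissible B 18 := by
  refine fun I hI => ⟨fun t => ⟨?_, greedyPlanner_respectsBids I t⟩, fun a y _ =>
    greedyPlanner_semiCount_le hB hI a y⟩
  refine greedyPlanner_valid hB hI _ ?_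
  rw [← Planner.getElem_rounds (greedyPlanner B) I (by rw [Planner.length_rounds]; exact t.2)]
  exact List.getElem_mem _

theorem isCompetitive_greedyPlanner (hB : ∀ a, 0 < B a) (P : PairSelector A)
    (hP : IsPanOCS B 18 (0.01245 / 18) P) :
    IsCompetitive B 0.50005 ((greedyPlanner B).combine B P) := by
  intro I hI
  have hR := greedyPlanner_valid hB hI
  have h1 := dual_le_payoff hB (greedyPlanner B) P hP I hR (greedyPlanner_respectsBids I)
    fun a y _ => greedyPlanner_semiCount_le hB hI a y
  -- Weak duality: the same dual value bounds every offline assignment from above and the expected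
  -- payoff from below.
  have h2 : offlineOpt B I ≤ (∫ ω, payoff B I (fun t =>
      ((greedyPlanner B).combine B P).act ω (I.take (t + 1))) ∂P.law) / 0.50005 := by
    refine ciSup_le fun f => ?_
    rw [le_div_iff₀ (by norm_num), mul_comm]
    exact (payoff_le_of_greedy hB _ hR I hI (Planner.length_rounds _ I)
      (fun t ht => isGreedyRound_getElem B I (by rwa [Planner.length_rounds] at ht)) f).trans h1
  rw [le_div_iff₀ (by norm_num), mul_comm] at h2
  exact h2

end Payoff

end

theorem mainTheorem4 {A : Type*} [Fintype A] [DecidableEq A] [Nonempty A]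
    (B : A → ℝ) (hB : ∀ a, 0 < B a) :
    (∀ kmax : ℕ, 1 ≤ kmax →
      ∃ P : PairSelector A, IsPanOCS B kmax (0.01245 / (kmax : ℝ)) P) ∧
    (∃ plan : Planner A, plan.Admissible B 18 ∧
      ∀ P : PairSelector A, IsPanOCS B 18 (0.01245 / 18) P →
        IsCompetitive B 0.50005 (plan.combine B P)) ∧
    (∃ alg : OnlineAlgorithm (A → ℝ) A, IsCompetitive B 0.50005 alg) := by
  have h1 : ∀ kmax : ℕ, 1 ≤ kmax →
      ∃ P : PairSelector A, IsPanOCS B kmax (0.01245 / (kmax : ℝ)) P := by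
    intro kmax hk
    obtain ⟨m, rfl⟩ := Nat.exists_eq_add_of_le' hk
    exact ⟨_, isPanOCS_orientSelector B hB (Fintype.equivFin A) m⟩
  refine ⟨h1, ⟨greedyPlanner B, greedyPlanner_admissible hB, isCompetitive_greedyPlanner hB⟩, ?_⟩
  obtain ⟨P, hP⟩ := h1 18 (by norm_num)
  exact ⟨_, isCompetitive_greedyPlanner hB P (by simpa using hP)⟩
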